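/- Let $\mathcal C$ be a symmetric monoidal abelian category with unit object $I$ and symmetry $\psi$, and let $(H,m,\eta,\Delta,\varepsilon,S)$ be a Hopf algebra in $\mathcal C$ which is commutative, i.e. $m\psi=m$. Write $H^n=H^{\otimes n}$, $H^0=I$. Then $(\varepsilon,\eta)$ is a braided modular pair in involution for $H$: $\varepsilon$ is an algebra map $H\to I$, $\eta$ is a coalgebra map $I\to H$, $\varepsilon\eta=\mathrm{id}_I$, and $m(m\otimes \mathrm{id})(S\eta\otimes\widetilde S^2\otimes\eta)=\mathrm{id}_H$, where $\widetilde S=(\varepsilon\otimes S)\Delta$. Moreover the objects $C^n=H^n$ with the cofaces $\delta_i:H^{n}\to H^{n+1}$, $$\delta_0=(\eta,1,\dots,1),\qquad \delta_i=(1,\dots,\underset{i\text{-th}}{\Delta},\dots,1)\ (1\le i\le n),\qquad \delta_{n+1}=(1,\dots,1,\eta),$$ the codegeneracies $\sigma_i=(1,\dots,\underset{(i+1)\text{-th}}{\varepsilon},\dots,1):H^{n+1}\to H^n$ $(0\le i\le n)$ and the cyclic operators $\tau_0=\mathrm{id}_I$, $\tau_n=m_{H^n}(\Delta^{n-1}\widetilde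 S\otimes 1_{H^{n-1}}\otimes\eta):H^n\to H^n$ $(n\ge1)$, where $m_{H^n}$ is the multiplication of the tensor power algebra $H^n$, form a cocyclic object in $\mathcal C$, and for every $n\ge 0$ there is an isomorphism in $\mathcal C$ $$HC^n_{(\varepsilon,\eta)}(H)\;\cong\;\bigoplus_{\substack{0\le i\le n\\ i\equiv n\ (\mathrm{mod}\ 2)}} HH^i(H,I).$$ Here $HC^n_{(\varepsilon,\eta)}(H)$ is the $n$-th cyclic cohomology of this cocyclic object, that is, the $n$-th cohomology of the total complex of the first-quadrant cyclic bicomplex whose entry in column $p$ and row $q$ is $H^q$, whose even columns have differential $b=\sum_{i=0}^{q+1}(-1)^i\delta_i$, whose odd columns have differential $-b'=-\sum_{i=0}^{q}(-1)^i\delta_i$, and whose rows have the differentials $1-t$ (from even to odd columns) and $1+t+\dots+t^q$ (from odd to even columns), with $t=(-1)^q\tau_q$. And $HH^i(H,I)$ is the $i$-th Hochschild cohomology of the coalgebra $H$ with coefficients in $I$, regarded as an $H$-bicomodule through $\eta$ on both sides, that is, the $i$-th cohomology of the complex $(H^n,\,b)_{n\ge0}$ with $b=\eta\otimes 1_{H^n}+\sum_{i=1}^{n}(-1)^i(1,\dots,\underset{i\text{-th}}{\Delta},\dots,1)+(-1)^{n+1}\,1_{H^n}\otimes\eta$.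 -/

import Mathlib

open CategoryTheory MonoidalCategory Limits
open scoped MonObj ComonObj HopfObj

universe v u

noncomputable section

namespace HopfCyclic

/-! ### Cocyclic objects -/

/-- The raw data of a cocyclic object: objects `X n`, cofaces `δ n i : X n ⟶ X (n + 1)` (relevant for
`i ≤ n + 1`), codegeneracies `σ n i : X (n + 1) ⟶ X n` (relevant for `i ≤ n`) and cyclic operators
`τ n : X n ⟶ X n`. The values outside the indicated ranges play no role. -/
structure CocyclicData (C : Type u) [Category.{v} C] where
  X : ℕ → C
  δ : ∀ n : ℕ, ℕ → (X n ⟶ X (n + 1))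
  σ : ∀ n : ℕ, ℕ → (X (n + 1) ⟶ X n)
  τ : ∀ n : ℕ, X n ⟶ X n

/-- The `k`-th power of an endomorphism. -/
def iter {C : Type u} [Category.{v} C] {A : C} (f : A ⟶ A) : ℕ → (A ⟶ A)
  | 0 => 𝟙 A
  | k + 1 => iter f k ≫ f

lemma iter_comm {C : Type u} [Category.{v} C] {A : C} (f : A ⟶ A) (k : ℕ) : f ≫ iter f k = iter f k ≫ f := by
  induction k with
  | zero => simp [iter]
  | succ k ih => simp only [iter]; rw [← Category.assoc, ih]

lemma iter_add {C : Type u} [Category.{v} C] {A : C} (f : A ⟶ A) (k l : ℕ) : iter f (k + l) = iter f k ≫ iter f l := by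
  induction l with
  | zero => simp [iter]
  | succ l ih => rw [← add_assoc]; simp only [iter]; rw [ih, Category.assoc]

/-- The axioms of a cocyclic object (Connes). Composition is written in diagrammatic order. -/
structure CocyclicData.IsCocyclic {C : Type u} [Category.{v} C] (D : CocyclicData C) : Prop where
  δ_δ : ∀ n i j, i ≤ j → j ≤ n + 1 → D.δ n i ≫ D.δ (n + 1) (j + 1) = D.δ n j ≫ D.δ (n + 1) i
  σ_σ : ∀ n i j, i ≤ j → j ≤ n → D.σ (n + 1) i ≫ D.σ n j = D.σ (n + 1) (j + 1) ≫ D.σ n i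
  δ_σ_lt : ∀ n i j, i ≤ j → j ≤ n → D.δ (n + 1) i ≫ D.σ (n + 1) (j + 1) = D.σ n j ≫ D.δ n i
  δ_σ_self : ∀ n i, i ≤ n → D.δ n i ≫ D.σ n i = 𝟙 (D.X n)
  δ_σ_succ : ∀ n i, i ≤ n → D.δ n (i + 1) ≫ D.σ n i = 𝟙 (D.X n)
  δ_σ_gt : ∀ n i j, j < i → i ≤ n + 1 →
    D.δ (n + 1) (i + 1) ≫ D.σ (n + 1) j = D.σ n j ≫ D.δ n i
  δ_zero_τ : ∀ n, D.δ n 0 ≫ D.τ (n + 1) = D.δ n (n + 1)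
  δ_succ_τ : ∀ n i, i ≤ n → D.δ n (i + 1) ≫ D.τ (n + 1) = D.τ n ≫ D.δ n i
  σ_zero_τ : ∀ n, D.σ n 0 ≫ D.τ n = D.τ (n + 1) ≫ D.τ (n + 1) ≫ D.σ n n
  σ_succ_τ : ∀ n i, i + 1 ≤ n → D.σ n (i + 1) ≫ D.τ n = D.τ (n + 1) ≫ D.σ n i
  τ_pow : ∀ n, iter (D.τ n) (n + 1) = 𝟙 (D.X n)

/-! ### Alternating sums of cofaces -/

section AltSum

variable {C : Type u} [Category.{v} C] [Preadditive C]

/-- The alternating sum `∑_{i < k} (-1)^i f i`. -/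
def altSum {A B : C} (k : ℕ) (f : ℕ → (A ⟶ B)) : A ⟶ B :=
  ∑ i ∈ Finset.range k, (-1 : ℤ) ^ i • f i

lemma altSum_comp_altSum {A B E : C} (k : ℕ) (f : ℕ → (A ⟶ B)) (g : ℕ → (B ⟶ E))
    (hfg : ∀ i j, i ≤ j → j < k → f i ≫ g (j + 1) = f j ≫ g i) :
    altSum k f ≫ altSum (k + 1) g = 0 := by
  simp only [altSum, Preadditive.sum_comp, Preadditive.comp_sum, Preadditive.zsmul_comp,
    Preadditive.comp_zsmul, Finset.smul_sum, smul_smul]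
  rw [Finset.sum_comm, ← Finset.sum_product']
  refine Finset.sum_involution
    (fun p _ => if p.1 < p.2 then (p.2 - 1, p.1) else (p.2, p.1 + 1)) ?_ ?_ ?_ ?_
  · rintro ⟨i, j⟩ hp
    simp only [Finset.mem_product, Finset.mem_range] at hp
    by_cases hij : i < j
    · obtain ⟨j, rfl⟩ : ∃ l, j = l + 1 := ⟨j - 1, by omega⟩
      simp only [hij, if_true, Nat.add_sub_cancel]
      rw [hfg i j (by omega) (by omega), ← add_smul]
      have : (-1 : ℤ) ^ (j + 1) * (-1) ^ i + (-1) ^ i * (-1) ^ j = 0 := by ring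
      rw [this, zero_smul]
    · simp only [hij, if_false]
      rw [hfg j i (by omega) (by omega), ← add_smul]
      have : (-1 : ℤ) ^ j * (-1) ^ i + (-1) ^ (i + 1) * (-1) ^ j = 0 := by ring
      rw [this, zero_smul]
  · rintro ⟨i, j⟩ hp _ h
    by_cases hij : i < j
    · simp only [hij, if_true, Prod.mk.injEq] at h; omega
    · simp only [hij, if_false, Prod.mk.injEq] at h; omega
  · rintro ⟨i, j⟩ hp
    simp only [Finset.mem_product, Finset.mem_range] at hp ⊢
    by_cases hij : i < j
    · simp only [hij, if_true]; omega
    · simp only [hij, if_false]; omega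
  · rintro ⟨i, j⟩ hp
    by_cases hij : i < j
    · have : ¬ (j - 1 < i) := by omega
      simp only [hij, if_true, this, if_false]
      ext <;> simp; omega
    · have : j < i + 1 := by omega
      simp [hij, this]

end AltSum

/-! ### Cyclic cohomology of a cocyclic object in an abelian category -/

section Cyclic

variable {C : Type u} [Category.{v} C] [Preadditive C]

namespace CocyclicData

variable (D : CocyclicData C)

/-- The Hochschild coboundary `b = ∑_{i=0}^{n+1} (-1)^i δ_i : X n ⟶ X (n + 1)`. -/
def b (n : ℕ) : D.X n ⟶ D.X (n + 1) := altSum (n + 2) (D.δ n)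

/-- The operator `b' = ∑_{i=0}^{n} (-1)^i δ_i : X n ⟶ X (n + 1)`, omitting the last coface. -/
def b' (n : ℕ) : D.X n ⟶ D.X (n + 1) := altSum (n + 1) (D.δ n)

/-- The signed cyclic operator `t = (-1)^n τ_n`. -/
def t (n : ℕ) : D.X n ⟶ D.X n := (-1 : ℤ) ^ n • D.τ n

/-- The norm operator `N = 1 + t + ⋯ + t^n`. -/
def N (n : ℕ) : D.X n ⟶ D.X n := ∑ k ∈ Finset.range (n + 1), iter (D.t n) k

/-- The vertical differential of the cyclic bicomplex: `b` in even columns, `b'` in odd columns. -/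
def vert (p q : ℕ) : D.X q ⟶ D.X (q + 1) := if Even p then D.b q else D.b' q

/-- The horizontal differential of the cyclic bicomplex from column `p` to column `p + 1`:
`1 - t` for `p` even, `N` for `p` odd. -/
def horiz (p q : ℕ) : D.X q ⟶ D.X q := if Even p then 𝟙 _ - D.t q else D.N q

variable {D}

lemma iter_zsmul {A : C} (f : A ⟶ A) (c : ℤ) (k : ℕ) : iter (c • f) k = c ^ k • iter f k := by
  induction k with
  | zero => simp [iter]
  | succ k ih =>
    simp only [iter, ih, Preadditive.zsmul_comp, Preadditive.comp_zsmul, smul_smul]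
    rw [pow_succ, mul_comm]

lemma IsCocyclic.b_b (h : D.IsCocyclic) (n : ℕ) : D.b n ≫ D.b (n + 1) = 0 :=
  altSum_comp_altSum _ _ _ fun i j hij hj => h.δ_δ n i j hij (by omega)

lemma IsCocyclic.b'_b' (h : D.IsCocyclic) (n : ℕ) : D.b' n ≫ D.b' (n + 1) = 0 :=
  altSum_comp_altSum _ _ _ fun i j hij hj => h.δ_δ n i j hij (by omega)

lemma IsCocyclic.t_pow (h : D.IsCocyclic) (n : ℕ) : iter (D.t n) (n + 1) = 𝟙 _ := by
  rw [t, iter_zsmul, h.τ_pow, ← pow_mul, (Nat.even_mul_succ_self n).neg_one_pow, one_smul]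

lemma IsCocyclic.t_comp_N (h : D.IsCocyclic) (n : ℕ) : D.t n ≫ D.N n = D.N n := by
  have h1 := Finset.sum_range_succ' (fun k => iter (D.t n) k) (n + 1)
  rw [Finset.sum_range_succ, h.t_pow] at h1
  simp only [iter, add_left_inj] at h1
  rw [N, Preadditive.comp_sum, h1]
  exact Finset.sum_congr rfl fun k _ => iter_comm _ _

lemma N_comp_t (n : ℕ) : D.N n ≫ D.t n = D.t n ≫ D.N n := by
  rw [N, Preadditive.comp_sum, Preadditive.sum_comp]
  exact Finset.sum_congr rfl fun k _ => (iter_comm _ _).symm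

lemma IsCocyclic.horiz_horiz (h : D.IsCocyclic) (p q : ℕ) :
    D.horiz p q ≫ D.horiz (p + 1) q = 0 := by
  unfold horiz
  by_cases hp : Even p
  · have : ¬ Even (p + 1) := by simpa [Nat.even_add_one] using hp
    rw [if_pos hp, if_neg this, Preadditive.sub_comp, Category.id_comp, h.t_comp_N, sub_self]
  · have : Even (p + 1) := by simpa [Nat.even_add_one] using hp
    rw [if_neg hp, if_pos this, Preadditive.comp_sub, Category.comp_id, N_comp_t, h.t_comp_N,
      sub_self]

lemma IsCocyclic.vert_vert (h : D.IsCocyclic) (p q : ℕ) :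
    D.vert p q ≫ D.vert p (q + 1) = 0 := by
  unfold vert
  split_ifs
  · exact h.b_b q
  · exact h.b'_b' q

/-- The signed coface `(-1)^i δ_i`. -/
def sδ (D : CocyclicData C) (n i : ℕ) : D.X n ⟶ D.X (n + 1) := (-1 : ℤ) ^ i • D.δ n i

lemma b_eq (n : ℕ) : D.b n = ∑ i ∈ Finset.range (n + 2), D.sδ n i := rfl

lemma b'_eq (n : ℕ) : D.b' n = ∑ i ∈ Finset.range (n + 1), D.sδ n i := rfl

lemma IsCocyclic.sδ_zero_t (h : D.IsCocyclic) (n : ℕ) :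
    D.sδ n 0 ≫ D.t (n + 1) = D.sδ n (n + 1) := by
  simp only [sδ, t, Preadditive.comp_zsmul, h.δ_zero_τ, pow_zero, one_smul]

lemma IsCocyclic.sδ_succ_t (h : D.IsCocyclic) (n i : ℕ) (hi : i ≤ n) :
    D.sδ n (i + 1) ≫ D.t (n + 1) = D.t n ≫ D.sδ n i := by
  simp only [sδ, t, Preadditive.zsmul_comp, Preadditive.comp_zsmul, h.δ_succ_τ n i hi, smul_smul]
  congr 1
  ring

lemma IsCocyclic.sδ_iter_le (h : D.IsCocyclic) (n j k : ℕ) (hi : j + k ≤ n + 1) :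
    D.sδ n (j + k) ≫ iter (D.t (n + 1)) k = iter (D.t n) k ≫ D.sδ n j := by
  induction k generalizing j with
  | zero => simp [iter]
  | succ k ih =>
    have := ih (j + 1) (by omega)
    rw [show j + (k + 1) = j + 1 + k by omega]
    simp only [iter]
    rw [← Category.assoc, this, Category.assoc, h.sδ_succ_t n j (by omega), Category.assoc]

lemma IsCocyclic.sδ_iter_gt (h : D.IsCocyclic) (n i l : ℕ) (hi : i ≤ n) (hl : i ≤ l)
    (hl' : l ≤ n) :
    D.sδ n i ≫ iter (D.t (n + 1)) (l + 1) = iter (D.t n) l ≫ D.sδ n (n + 1 + i - l) := by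
  obtain ⟨m, rfl⟩ := Nat.exists_eq_add_of_le hl
  have h1 := h.sδ_iter_le n 0 i (by omega)
  have h2 := h.sδ_iter_le n (n + 1 - m) m (by omega)
  rw [zero_add] at h1
  rw [show n + 1 - m + m = n + 1 by omega] at h2
  have e : iter (D.t (n + 1)) (i + m + 1) =
      iter (D.t (n + 1)) i ≫ D.t (n + 1) ≫ iter (D.t (n + 1)) m := by
    rw [iter_comm, add_assoc, iter_add]
    rfl
  rw [e, ← Category.assoc, h1, Category.assoc, ← Category.assoc (D.sδ n 0), h.sδ_zero_t, h2,
    iter_add, Category.assoc]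
  congr 3
  omega

lemma IsCocyclic.b'_N (h : D.IsCocyclic) (n : ℕ) : D.b' n ≫ D.N (n + 1) = D.N n ≫ D.b n := by
  rw [b'_eq, b_eq, N, N]
  simp only [Preadditive.sum_comp, Preadditive.comp_sum]
  rw [← Finset.sum_product', ← Finset.sum_product']
  refine Finset.sum_bij'
    (fun p _ => if p.1 ≤ p.2 then (p.2 - p.1, p.1) else (n + 1 + p.2 - (p.1 - 1), p.1 - 1))
    (fun p _ => if p.1 + p.2 ≤ n then (p.2, p.1 + p.2) else (p.2 + 1, p.1 + p.2 - (n + 1)))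
    ?_ ?_ ?_ ?_ ?_
  · rintro ⟨k, i⟩ hp
    simp only [Finset.mem_product, Finset.mem_range] at hp
    split_ifs <;> simp only [Finset.mem_product, Finset.mem_range] <;> omega
  · rintro ⟨j, l⟩ hp
    simp only [Finset.mem_product, Finset.mem_range] at hp
    split_ifs <;> simp only [Finset.mem_product, Finset.mem_range] <;> omega
  · rintro ⟨k, i⟩ hp
    simp only [Finset.mem_product, Finset.mem_range] at hp
    by_cases hk : k ≤ i
    · have : i - k + k ≤ n := by omega
      simp only [hk, if_true, this, Prod.mk.injEq]
      exact ⟨trivial, by omega⟩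
    · have : ¬ (n + 1 + i - (k - 1) + (k - 1) ≤ n) := by omega
      simp only [hk, if_false, this, Prod.mk.injEq]
      omega
  · rintro ⟨j, l⟩ hp
    simp only [Finset.mem_product, Finset.mem_range] at hp
    by_cases hk : j + l ≤ n
    · have : l ≤ j + l := by omega
      simp only [hk, if_true, this, Prod.mk.injEq]
      exact ⟨by omega, trivial⟩
    · have : ¬ (l + 1 ≤ j + l - (n + 1)) := by omega
      simp only [hk, if_false, this, Prod.mk.injEq]
      omega
  · rintro ⟨k, i⟩ hp
    simp only [Finset.mem_product, Finset.mem_range] at hp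
    by_cases hk : k ≤ i
    · obtain ⟨j, rfl⟩ := Nat.exists_eq_add_of_le' hk
      simp only [hk, if_true, Nat.add_sub_cancel]
      exact h.sδ_iter_le n j k (by omega)
    · obtain ⟨l, rfl⟩ : ∃ l, k = l + 1 := ⟨k - 1, by omega⟩
      simp only [hk, if_false, Nat.add_sub_cancel]
      exact h.sδ_iter_gt n i l (by omega) (by omega) (by omega)

lemma IsCocyclic.b_one_sub_t (h : D.IsCocyclic) (n : ℕ) :
    D.b n ≫ (𝟙 _ - D.t (n + 1)) = (𝟙 _ - D.t n) ≫ D.b' n := by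
  have key : D.b n ≫ D.t (n + 1) = D.t n ≫ D.b' n + D.sδ n (n + 1) := by
    rw [b_eq, Finset.sum_range_succ', Preadditive.add_comp, h.sδ_zero_t, b'_eq,
      Preadditive.comp_sum, Preadditive.sum_comp]
    congr 1
    exact Finset.sum_congr rfl fun i hi => h.sδ_succ_t n i (by simp at hi; omega)
  have e : D.b n = D.b' n + D.sδ n (n + 1) := by rw [b_eq, b'_eq, Finset.sum_range_succ]
  rw [Preadditive.comp_sub, Preadditive.sub_comp, key, Category.comp_id, Category.id_comp, e]
  abel

lemma IsCocyclic.horiz_vert (h : D.IsCocyclic) (p q : ℕ) :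
    D.horiz p q ≫ D.vert (p + 1) q = D.vert p q ≫ D.horiz p (q + 1) := by
  unfold horiz vert
  by_cases hp : Even p
  · have : ¬ Even (p + 1) := by simpa [Nat.even_add_one] using hp
    rw [if_pos hp, if_pos hp, if_neg this, if_pos hp, h.b_one_sub_t]
  · have : Even (p + 1) := by simpa [Nat.even_add_one] using hp
    rw [if_neg hp, if_neg hp, if_pos this, if_neg hp, h.b'_N]

/-- The `p`-th column of the cyclic bicomplex. -/
def IsCocyclic.column (h : D.IsCocyclic) (p : ℕ) : CochainComplex C ℕ :=
  CochainComplex.of D.X (D.vert p) (h.vert_vert p)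

/-- The first-quadrant cyclic bicomplex (Tsygan's bicomplex): its entry in column `p` and row `q` is
`X q`, and its columns and rows are
`X 0 --b--> X 1 --b--> ⋯` (`p` even), `X 0 --b'--> X 1 --b'--> ⋯` (`p` odd) and
`X q --(1-t)--> X q --N--> X q --(1-t)--> ⋯`. All squares commute; the sign `(-1)^p` that is
needed on the vertical differentials is part of the formation of the total complex. -/
def IsCocyclic.cyclicBicomplex (h : D.IsCocyclic) :
    HomologicalComplex₂ C (ComplexShape.up ℕ) (ComplexShape.up ℕ) :=
  CochainComplex.of h.column
    (fun p => CochainComplex.ofHom (fun q => D.horiz p q) fun q => by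
      simpa [column] using h.horiz_vert p q)
    fun p => by
      ext q
      exact h.horiz_horiz p q

end CocyclicData

end Cyclic

section Cohomology

/-- The signs `(-1)^p` for total complexes of first-quadrant bicomplexes of cochains. -/
instance : (ComplexShape.up ℕ).TensorSigns where
  ε' := MonoidHom.mk' (fun (i : ℕ) => (-1 : ℤˣ) ^ i) (pow_add (-1 : ℤˣ))
  rel_add p q r (hpq : p + 1 = q) := show p + r + 1 = q + r by omega
  add_rel p q r (hpq : p + 1 = q) := show r + p + 1 = r + q by omega
  ε'_succ := by
    rintro p _ rfl
    exact (pow_succ (-1 : ℤˣ) p).trans (mul_neg_one _)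

instance {C : Type u} [Category.{v} C] [Preadditive C] [HasFiniteCoproducts C]
    (K : HomologicalComplex₂ C (ComplexShape.up ℕ) (ComplexShape.up ℕ)) :
    K.HasTotal (ComplexShape.up ℕ) := by
  intro n
  have : Finite ((ComplexShape.π (ComplexShape.up ℕ) (ComplexShape.up ℕ) (ComplexShape.up ℕ)) ⁻¹'
      {n}) := by
    refine Set.Finite.subset ((Set.finite_Iic n).prod (Set.finite_Iic n)) ?_
    rintro ⟨p, q⟩ (h : p + q = n)
    simp only [Set.mem_prod, Set.mem_Iic]
    omega
  infer_instance

variable {C : Type u} [Category.{v} C] [Abelian C] {D : CocyclicData C}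

/-- The `n`-th cyclic cohomology object of a cocyclic object: the `n`-th cohomology of the total
complex of its cyclic bicomplex. -/
def CocyclicData.IsCocyclic.cyclicCohomology (h : D.IsCocyclic) (n : ℕ) : C :=
  (h.cyclicBicomplex.total (ComplexShape.up ℕ)).homology n

end Cohomology

/-! ### Hopf algebras in braided monoidal categories -/

section Hopf

variable {C : Type u} [Category.{v} C] [MonoidalCategory C]

/-- The tensor powers `H^0 = I`, `H^{n+1} = H ⊗ H^n`. -/
def tpow (H : C) : ℕ → C
  | 0 => 𝟙_ C
  | n + 1 => H ⊗ tpow H n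

/-- A cocharacter (group-like element) of a coalgebra: a morphism `σ : I ⟶ H` with
`Δ σ = σ ⊗ σ` and `ε σ = id`. -/
structure IsCocharacter (H : C) [ComonObj H] (σ : 𝟙_ C ⟶ H) : Prop where
  comul : σ ≫ Δ[H] = (λ_ (𝟙_ C)).inv ≫ (σ ⊗ₘ σ)
  counit : σ ≫ ε[H] = 𝟙 (𝟙_ C)

/-- A character of an algebra: a morphism `δ : H ⟶ I` with `δ m = δ ⊗ δ` and `δ η = id`. -/
structure IsCharacter (H : C) [MonObj H] (δ : H ⟶ 𝟙_ C) : Prop where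
  mul : μ[H] ≫ δ = (δ ⊗ₘ δ) ≫ (λ_ (𝟙_ C)).hom
  one : η[H] ≫ δ = 𝟙 (𝟙_ C)

/-- The cofaces `H^n ⟶ H^{n+1}` attached to morphisms `α β : I ⟶ H` : the `0`-th one is
`(α, 1, …, 1)`, the `i`-th one for `1 ≤ i ≤ n` is `(1, …, Δ, …, 1)` with `Δ` applied to the `i`-th
factor, and the `(n+1)`-st one is `(1, …, 1, β)`. (The value for `i > n + 1` is irrelevant.) -/
def coface (H : C) [ComonObj H] (α β : 𝟙_ C ⟶ H) : ∀ n : ℕ, ℕ → (tpow H n ⟶ tpow H (n + 1))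
  | n, 0 => (λ_ (tpow H n)).inv ≫ α ▷ tpow H n
  | 0, _ + 1 => (λ_ (𝟙_ C)).inv ≫ β ▷ 𝟙_ C
  | n + 1, 1 => Δ[H] ▷ tpow H n ≫ (α_ H H (tpow H n)).hom
  | n + 1, i + 2 => H ◁ coface H α β n (i + 1)

/-- The codegeneracies `H^{n+1} ⟶ H^n`: `(1, …, ε, …, 1)` with `ε` applied to the `(i+1)`-st factor,
for `0 ≤ i ≤ n`. (The value for `i > n` is irrelevant.) -/
def codegen (H : C) [ComonObj H] : ∀ n : ℕ, ℕ → (tpow H (n + 1) ⟶ tpow H n)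
  | n, 0 => ε[H] ▷ tpow H n ≫ (λ_ (tpow H n)).hom
  | 0, _ + 1 => ε[H] ▷ 𝟙_ C ≫ (λ_ (𝟙_ C)).hom
  | n + 1, i + 1 => H ◁ codegen H n i

/-- The iterated comultiplication `Δ^{n-1} : H ⟶ H^n` (for `n = 0` it is the counit, and for `n = 1`
the identity up to `H ≅ H ⊗ I`). -/
def iterComul (H : C) [ComonObj H] : ∀ n : ℕ, H ⟶ tpow H n
  | 0 => ε[H]
  | n + 1 => Δ[H] ≫ H ◁ iterComul H n

lemma insert_comp (H : C) (α : 𝟙_ C ⟶ H) {X Y : C} (f : X ⟶ Y) :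
    ((λ_ X).inv ≫ α ▷ X) ≫ H ◁ f = f ≫ (λ_ Y).inv ≫ α ▷ Y := by
  rw [Category.assoc, ← whisker_exchange, leftUnitor_inv_naturality_assoc]

lemma insert_comul (H : C) [ComonObj H] {α : 𝟙_ C ⟶ H} (hα : IsCocharacter H α) (X : C) :
    ((λ_ X).inv ≫ α ▷ X) ≫ Δ[H] ▷ X ≫ (α_ H H X).hom =
      ((λ_ X).inv ≫ α ▷ X) ≫ (λ_ (H ⊗ X)).inv ≫ α ▷ (H ⊗ X) := by
  rw [← insert_comp, Category.assoc, ← comp_whiskerRight_assoc, hα.comul,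
    MonoidalCategory.tensorHom_def]
  monoidal

lemma comul_comul (H : C) [ComonObj H] (X : C) :
    (Δ[H] ▷ X ≫ (α_ H H X).hom) ≫ H ◁ (Δ[H] ▷ X ≫ (α_ H H X).hom) =
      (Δ[H] ▷ X ≫ (α_ H H X).hom) ≫ Δ[H] ▷ (H ⊗ X) ≫ (α_ H H (H ⊗ X)).hom := by
  have h := congrArg (fun f => f ▷ X ≫ (α_ H (H ⊗ H) X).hom ≫ H ◁ (α_ H H X).hom)
    (ComonObj.comul_assoc H)
  simp only [comp_whiskerRight, Category.assoc] at h
  simp only [whiskerLeft_comp, Category.assoc]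
  rw [← associator_naturality_middle_assoc, h]
  monoidal

lemma comul_comp (H : C) [ComonObj H] {X Y : C} (f : X ⟶ Y) :
    (Δ[H] ▷ X ≫ (α_ H H X).hom) ≫ H ◁ H ◁ f = H ◁ f ≫ Δ[H] ▷ Y ≫ (α_ H H Y).hom := by
  rw [whisker_exchange_assoc]
  simp

lemma coface_comp_coface (H : C) [ComonObj H] {α β : 𝟙_ C ⟶ H} (hα : IsCocharacter H α)
    (hβ : IsCocharacter H β) : ∀ n i j : ℕ, i ≤ j → j ≤ n + 1 →
      coface H α β n i ≫ coface H α β (n + 1) (j + 1) =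
        coface H α β n j ≫ coface H α β (n + 1) i
  | n, 0, 0, _, _ => by
    cases n <;> exact insert_comul H hα _
  | n, 0, j + 1, _, _ => by
    cases n <;> exact insert_comp H α (coface H α β _ (j + 1))
  | 0, i + 1, j + 1, h1, h2 => by
    obtain rfl : j = 0 := by omega
    obtain rfl : i = 0 := by omega
    exact (insert_comp H β ((λ_ (𝟙_ C)).inv ≫ β ▷ 𝟙_ C)).trans (insert_comul H hβ _).symm
  | n + 1, 1, 1, _, _ => comul_comul H (tpow H n)
  | n + 1, 1, j + 2, _, _ => comul_comp H (coface H α β n (j + 1))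
  | n + 1, i + 2, j + 2, h1, h2 =>
    ((whiskerLeft_comp H _ _).symm.trans (congrArg (fun f => H ◁ f)
      (coface_comp_coface H hα hβ n (i + 1) (j + 1) (by omega) (by omega)))).trans
      (whiskerLeft_comp H _ _)

section Braided

variable [BraidedCategory C]

/-- The multiplication `m_n : H^n ⊗ H^n ⟶ H^n` of the `n`-th tensor power of an algebra `H`:
`(a_1, …, a_n) ⊗ (b_1, …, b_n) ↦ (a_1 b_1, …, a_n b_n)`, where the factors are shuffled by means of
the braiding. -/
def mulPow (H : C) [MonObj H] : ∀ n : ℕ, tpow H n ⊗ tpow H n ⟶ tpow H n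
  | 0 => (λ_ (𝟙_ C)).hom
  | n + 1 => tensorμ H (tpow H n) H (tpow H n) ≫ (μ[H] ⊗ₘ mulPow H n)

/-- The twisted antipode `(δ ⊗ S) Δ`. -/
def twistedAntipode (H : C) [HopfObj H] (δ : H ⟶ 𝟙_ C) : H ⟶ H :=
  Δ[H] ≫ (δ ⊗ₘ 𝒮[H]) ≫ (λ_ H).hom

/-- A braided modular pair in involution: a character `δ` and a cocharacter `σ` such that
`δ σ = id` and `m (m ⊗ id) (S σ ⊗ S̃² ⊗ σ) = id`, where `S̃` is the `δ`-twisted antipode. -/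
structure IsModularPairInInvolution (H : C) [HopfObj H] (δ : H ⟶ 𝟙_ C) (σ : 𝟙_ C ⟶ H) : Prop where
  character : IsCharacter H δ
  cocharacter : IsCocharacter H σ
  modular : σ ≫ δ = 𝟙 (𝟙_ C)
  involution :
    (ρ_ H).inv ≫ (λ_ H).inv ▷ 𝟙_ C ≫
      (((σ ≫ 𝒮[H]) ⊗ₘ (twistedAntipode H δ ≫ twistedAntipode H δ)) ⊗ₘ σ) ≫
        μ[H] ▷ H ≫ μ[H] = 𝟙 H

/-- The cyclic operators `τ_0 = id` and `τ_n = m_n (Δ^{n-1} S̃, 1_{H^{n-1}}, σ)` for `n ≥ 1`. -/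
def cyclicOp (H : C) [HopfObj H] (δ : H ⟶ 𝟙_ C) (σ : 𝟙_ C ⟶ H) : ∀ n : ℕ, tpow H n ⟶ tpow H n
  | 0 => 𝟙 (𝟙_ C)
  | n + 1 => ((twistedAntipode H δ ≫ iterComul H (n + 1)) ⊗ₘ coface H η[H] σ n (n + 1)) ≫
      mulPow H (n + 1)

/-- The braided Connes–Moscovici cocyclic object of a braided Hopf algebra `H` with respect to
`(δ, σ)`: the objects are `H^n` (with `H^0 = I`), the cofaces are `(η, 1, …, 1)`, `(1, …, Δ, …, 1)`
and `(1, …, 1, σ)`. -/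
def hopfCocyclicData (H : C) [HopfObj H] (δ : H ⟶ 𝟙_ C) (σ : 𝟙_ C ⟶ H) : CocyclicData C where
  X := tpow H
  δ := coface H η[H] σ
  σ := codegen H
  τ := cyclicOp H δ σ

end Braided

section Hochschild

variable [Preadditive C]

/-- The Hochschild cochain complex of a coalgebra `H` with coefficients in the unit object `I`,
regarded as an `H`-bicomodule by means of two cocharacters `α` and `β` (the `H`-coactions
`I ⟶ I ⊗ H = H` and `I ⟶ H ⊗ I = H` of `I`):
the cochains of degree `n` are `I ⊗ H^n = H^n`, and the differential is
`(α, 1, …, 1) + ∑_{i=1}^n (-1)^i (1, …, Δ, …, 1) + (-1)^{n+1} (1, …, 1, β)`. -/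
def hochschildComplex (H : C) [ComonObj H] {α β : 𝟙_ C ⟶ H} (hα : IsCocharacter H α)
    (hβ : IsCocharacter H β) : CochainComplex C ℕ :=
  CochainComplex.of (tpow H) (fun n => altSum (n + 2) (coface H α β n)) fun n =>
    altSum_comp_altSum _ _ _ fun i j hij hj => coface_comp_coface H hα hβ n i j hij (by omega)

end Hochschild

/-- The unit of a braided bialgebra is a cocharacter. -/
lemma isCocharacter_one [BraidedCategory C] (H : C) [BimonObj H] : IsCocharacter H η[H] where
  comul := by rw [BimonObj.one_comul]; rfl
  counit := BimonObj.one_counit H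

/-- The Hochschild cohomology `HH^n(H, I)` of the coalgebra underlying a braided bialgebra `H`, with
coefficients in the trivial `H`-bicomodule `I` (both coactions are given by the unit `η` of `H`). -/
def hochschildCohomology {C : Type u} [Category.{v} C] [Abelian C] [MonoidalCategory C]
    [BraidedCategory C] (H : C) [BimonObj H] (n : ℕ) : C :=
  (hochschildComplex H (isCocharacter_one H) (isCocharacter_one H)).homology n

end Hopf

end HopfCyclic

end

attribute [local instance] CategoryTheory.Abelian.hasFiniteBiproducts

universe v' u'

set_option linter.unusedSectionVars false

/-! A commutative Hopf algebra $H$ is the coordinate algebra of an affine group scheme $G$: for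
every commutative monoid object $R$ the monoid morphisms $H\to R$ form a group $G(R)$, and $H^n$
represents $n$-tuples $(a_0,\dots,a_{n-1})$ of points. In the homogeneous coordinates $g_k=a_0\cdots
a_{k-1}$, $0\le k\le n$, such a tuple is an $(n+1)$-tuple of points up to left translation, so every
map $\{0,\dots,m\}\to\{0,\dots,n\}$ of vertex sets, monotone or not, induces a morphism $H^m\to H^n$
(`vertexFunctor`). Cofaces, codegeneracies and cyclic operators come from the coface maps, the
codegeneracy maps and the rotation of vertices (`coface_lift`, `codegen_lift`, `cyclicOp_lift`), so
the cocyclic identities reduce to identities between maps of finite sets.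

The same functoriality splits cyclic cohomology. Formal integral combinations of maps into
$\{0,\dots,n\}$ are the chains of a simplex, which coning off contracts. Hence, by the method of
acyclic models, there is a morphism of complexes from $(X,b)$ to the total complex of the cyclic
bicomplex that is the identity in column $0$ (`VertexCat.b_comp_trivialization`). The cone acts on
formal combinations of vertex maps and is not composition with a morphism of $\mathcal C$; therefore
the construction takes place in the free preadditive category on `VertexCat` and is transported to
$\mathcal C$ afterwards. Only biadditivity of composition in $\mathcal C$ is used, never additivity
of the tensor product.

In the total complex, column $0$ is a quotient, now split; column $1$ is a contractible subquotient,
because the last codegeneracy contracts $b'$; the columns $p\ge2$ form a subcomplex isomorphic to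
the total complex shifted by two. Thus $HC^n\cong HH^n\oplus HC^{n-2}$
(`nonempty_homology_iso_of_splitting`), and induction in steps of two gives the theorem.

The involution condition reduces to $S^2=\mathrm{id}$, which holds for commutative $H$. -/

namespace HopfCyclic

/-! ### The group of points of a commutative Hopf algebra -/

section Points

variable {C : Type u} [Category.{v} C] [MonoidalCategory C] [SymmetricCategory C]

/-- The `R`-points of `H`: monoid morphisms `H ⟶ R`. -/
@[ext]
structure Points (H R : C) [MonObj H] [MonObj R] : Type v where
  hom : H ⟶ R
  isMonHom : IsMonHom hom

namespace Points

variable {H R R' : C}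

instance isMonHom_hom [MonObj H] [MonObj R] (a : Points H R) : IsMonHom a.hom := a.isMonHom

/-- A monoid morphism `R ⟶ R'` pushes `R`-points to `R'`-points. -/
def push [MonObj H] [MonObj R] [MonObj R'] (φ : R ⟶ R') [IsMonHom φ] (a : Points H R) :
    Points H R' :=
  ⟨a.hom ≫ φ, inferInstance⟩

/-- Multiplication of a commutative monoid is a monoid morphism. -/
instance isMonHom_mul (R : C) [MonObj R] [IsCommMonObj R] : IsMonHom μ[R] where
  one_hom := by
    rw [MonObj.tensorObj.one_def]
    simp [MonoidalCategory.tensorHom_def, ← unitors_equal]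
  mul_hom := by simp [MonObj.tensorObj.mul_def]

section

variable [MonObj R] [IsCommMonObj R] [BimonObj H]

instance isMonHom_comul : IsMonHom Δ[H] where
  one_hom := by simp
  mul_hom := by simp [MonObj.tensorObj.mul_def]

instance isMonHom_counit : IsMonHom ε[H] where
  one_hom := by simp
  mul_hom := by simp

instance isMonHom_one : IsMonHom η[R] where
  one_hom := by simp
  mul_hom := by simp [MonoidalCategory.tensorHom_def, ← unitors_equal]

lemma comul_tensorHom_mul (f g : H ⟶ R) :
    Δ[H] ≫ (f ⊗ₘ g) ≫ μ[R] = (show Conv H R from f) * (show Conv H R from g) := by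
  rw [Conv.mul_eq, MonoidalCategory.tensorHom_def, Category.assoc]

/-- This is the convolution product. Commutativity of `R` makes `μ[R]` a monoid morphism, so the
convolution of two points is again a point. -/
instance : Monoid (Points H R) where
  one := ⟨ε[H] ≫ η[R], inferInstance⟩
  mul a b := ⟨Δ[H] ≫ (a.hom ⊗ₘ b.hom) ≫ μ[R], inferInstance⟩
  one_mul a := Points.ext ((comul_tensorHom_mul _ _).trans (one_mul (M := Conv H R) a.hom))
  mul_one a := Points.ext ((comul_tensorHom_mul _ _).trans (mul_one (M := Conv H R) a.hom))
  mul_assoc a b c := Points.ext <| by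
    change Δ[H] ≫ ((Δ[H] ≫ (a.hom ⊗ₘ b.hom) ≫ μ[R]) ⊗ₘ c.hom) ≫ μ[R] =
      Δ[H] ≫ (a.hom ⊗ₘ (Δ[H] ≫ (b.hom ⊗ₘ c.hom) ≫ μ[R])) ≫ μ[R]
    have h : Δ[H] ≫ (Δ[H] ≫ a.hom ▷ H ≫ R ◁ b.hom ≫ μ[R]) ▷ H ≫ R ◁ c.hom ≫ μ[R] =
        Δ[H] ≫ a.hom ▷ H ≫ R ◁ (Δ[H] ≫ b.hom ▷ H ≫ R ◁ c.hom ≫ μ[R]) ≫ μ[R] :=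
      mul_assoc (G := Conv H R) a.hom b.hom c.hom
    simpa only [MonoidalCategory.tensorHom_def, Category.assoc] using h

lemma mul_hom (a b : Points H R) : (a * b).hom = Δ[H] ≫ (a.hom ⊗ₘ b.hom) ≫ μ[R] := rfl

end

section

variable [MonObj R] [IsCommMonObj R] [HopfObj H] [IsCommMonObj H]

/-- The antipode always reverses products; commutativity of `H` turns this into multiplicativity, so
that inverses of points are points. -/
instance isMonHom_antipode : IsMonHom 𝒮[H] where
  one_hom := by simp
  mul_hom := by
    rw [HopfObj.mul_antipode, IsCommMonObj.mul_comm]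

instance : Group (Points H R) where
  inv a := ⟨𝒮[H] ≫ a.hom, inferInstance⟩
  inv_mul_cancel a := Points.ext <| by
    change Δ[H] ≫ ((𝒮[H] ≫ a.hom) ⊗ₘ a.hom) ≫ μ[R] = ε[H] ≫ η[R]
    rw [← IsMonHom.one_hom a.hom, ← HopfObj.antipode_left_assoc, IsMonHom.mul_hom,
      whiskerRight_comp_tensorHom_assoc]

lemma inv_hom (a : Points H R) : (a⁻¹).hom = 𝒮[H] ≫ a.hom := rfl

lemma push_mul [MonObj R'] [IsCommMonObj R'] (φ : R ⟶ R') [IsMonHom φ] (a b : Points H R) :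
    (a * b).push φ = a.push φ * b.push φ :=
  Points.ext <| by
    change (Δ[H] ≫ (a.hom ⊗ₘ b.hom) ≫ μ[R]) ≫ φ = Δ[H] ≫ (a.hom ≫ φ ⊗ₘ b.hom ≫ φ) ≫ μ[R']
    simp

/-- Pushing points forward is a group homomorphism. -/
def pushHom [MonObj R'] [IsCommMonObj R'] (φ : R ⟶ R') [IsMonHom φ] :
    Points H R →* Points H R' :=
  MonoidHom.mk' (push φ) (push_mul φ)

end

end Points

/-! ### Tensor powers as representing objects of tuples of points -/

instance tpowMonObj (H : C) [MonObj H] : ∀ n, MonObj (tpow H n)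
  | 0 => inferInstanceAs (MonObj (𝟙_ C))
  | n + 1 => letI := tpowMonObj H n; inferInstanceAs (MonObj (H ⊗ tpow H n))

instance tpowIsComm (H : C) [MonObj H] [IsCommMonObj H] : ∀ n, IsCommMonObj (tpow H n)
  | 0 => inferInstanceAs (IsCommMonObj (𝟙_ C))
  | n + 1 => letI := tpowIsComm H n; inferInstanceAs (IsCommMonObj (H ⊗ tpow H n))

lemma mulPow_eq (H : C) [MonObj H] : ∀ n, mulPow H n = μ[tpow H n]
  | 0 => rfl
  | n + 1 => by
    rw [mulPow, mulPow_eq H n]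
    rfl

section Lift

variable {H R R' : C} [HopfObj H] [IsCommMonObj H] [MonObj R] [IsCommMonObj R] [MonObj R']
  [IsCommMonObj R']

/-- The monoid morphism `H^n ⟶ R` whose components are the first `n` terms of a sequence of
points. -/
def lift : ∀ n : ℕ, (ℕ → Points H R) → (tpow H n ⟶ R)
  | 0, _ => η[R]
  | n + 1, a => ((a 0).hom ⊗ₘ lift n fun k => a (k + 1)) ≫ μ[R]

lemma lift_congr : ∀ (n : ℕ) {a b : ℕ → Points H R}, (∀ k < n, a k = b k) → lift n a = lift n b
  | 0, _, _, _ => rfl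
  | n + 1, _, _, h => by
    simp only [lift]
    rw [h 0 (by omega), lift_congr n fun k hk => h (k + 1) (by omega)]

instance isMonHom_lift : ∀ (n : ℕ) (a : ℕ → Points H R), IsMonHom (lift n a)
  | 0, _ => Points.isMonHom_one
  | n + 1, a => by
    have := isMonHom_lift n fun k => a (k + 1)
    exact inferInstanceAs (IsMonHom (((a 0).hom ⊗ₘ lift n fun k => a (k + 1)) ≫ μ[R]))

lemma lift_comp (φ : R ⟶ R') [IsMonHom φ] : ∀ (n : ℕ) (a : ℕ → Points H R),
    lift n a ≫ φ = lift n fun k => (a k).push φ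
  | 0, _ => IsMonHom.one_hom φ
  | n + 1, a => by
    simp only [lift]
    rw [← lift_comp φ n]
    change (((a 0).hom ⊗ₘ lift n fun k => a (k + 1)) ≫ μ[R]) ≫ φ =
      (((a 0).hom ≫ φ) ⊗ₘ ((lift n fun k => a (k + 1)) ≫ φ)) ≫ μ[R']
    simp

/-- Insertion of the unit in front of an object, as a monoid morphism. -/
instance isMonHom_inr (H X : C) [MonObj H] [MonObj X] :
    IsMonHom (N := H ⊗ X) ((λ_ X).inv ≫ η[H] ▷ X) := inferInstance

instance isMonHom_inl (H X : C) [MonObj H] [MonObj X] :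
    IsMonHom (N := H ⊗ X) ((ρ_ H).inv ≫ H ◁ η[X]) := inferInstance

/-- The tautological points of `H^n`. -/
def taut (H : C) [HopfObj H] [IsCommMonObj H] : ∀ n : ℕ, ℕ → Points H (tpow H n)
  | 0, _ => 1
  | n + 1, 0 => ⟨(ρ_ H).inv ≫ H ◁ η[tpow H n], isMonHom_inl H (tpow H n)⟩
  | n + 1, k + 1 => (taut H n k).push (R' := H ⊗ tpow H n) ((λ_ (tpow H n)).inv ≫ η[H] ▷ tpow H n)

/-- The elementwise identity $(h\otimes 1)(1\otimes x)=h\otimes x$; the braiding disappears because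
it only moves unit objects. -/
lemma inl_tensor_inr_mul (H X : C) [MonObj H] [MonObj X] :
    (((ρ_ H).inv ≫ H ◁ η[X]) ⊗ₘ ((λ_ X).inv ≫ η[H] ▷ X)) ≫ μ[H ⊗ X] = 𝟙 (H ⊗ X) := by
  rw [MonObj.tensorObj.mul_def, ← tensorHom_comp_tensorHom, ← id_tensorHom, ← tensorHom_id,
    Category.assoc, tensorμ_natural_assoc, tensorHom_comp_tensorHom, id_tensorHom, tensorHom_id,
    MonObj.one_mul, MonObj.mul_one]
  simp only [tensorμ, braiding_tensorUnit_left]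
  monoidal

/-- The Yoneda principle: a morphism into $H^n$ is determined by its effect on the tautological
tuple. -/
lemma lift_taut : ∀ n : ℕ, lift n (taut H n) = 𝟙 (tpow H n)
  | 0 => rfl
  | n + 1 => by
    have h := lift_comp (H := H) (R := tpow H n) (R' := H ⊗ tpow H n)
      ((λ_ (tpow H n)).inv ≫ η[H] ▷ tpow H n) n (taut H n)
    rw [lift_taut n, Category.id_comp] at h
    have := inl_tensor_inr_mul H (tpow H n)
    rw [h] at this
    exact this

end Lift

end Points
end HopfCyclic

namespace HopfCyclic

/-! ### Homogeneous coordinates on sequences in a group -/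

section PartialProducts

variable {G : Type*} [Group G]

/-- The product of the first `n` terms of a sequence. -/
def partialProd (a : ℕ → G) : ℕ → G
  | 0 => 1
  | n + 1 => partialProd a n * a n

lemma partialProd_succ' (a : ℕ → G) (n : ℕ) :
    partialProd a (n + 1) = a 0 * partialProd (fun k => a (k + 1)) n := by
  induction n with
  | zero => simp [partialProd]
  | succ n ih => rw [partialProd, ih, partialProd, mul_assoc]

/-- In terms of homogeneous coordinates `g_k = a_0 ⋯ a_{k-1}`, the sequence `g_{f 0}, g_{f 1}, …`. -/
def reindex (f : ℕ → ℕ) (a : ℕ → G) (k : ℕ) : G :=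
  (partialProd a (f k))⁻¹ * partialProd a (f (k + 1))

lemma partialProd_reindex (f : ℕ → ℕ) (a : ℕ → G) (n : ℕ) :
    partialProd (reindex f a) n = (partialProd a (f 0))⁻¹ * partialProd a (f n) := by
  induction n with
  | zero => simp [partialProd]
  | succ n ih => rw [partialProd, ih, reindex]; group

/-- The sequence `reindex g a` has homogeneous coordinates $g_{g(0)}^{-1}g_{g(k)}$; the common left
factor cancels in successive quotients. This is the contravariant functoriality on which everything
rests. -/
lemma reindex_reindex (f g : ℕ → ℕ) (a : ℕ → G) :
    reindex f (reindex g a) = reindex (fun k => g (f k)) a := by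
  ext k
  simp only [reindex, partialProd_reindex]
  group

lemma reindex_id (a : ℕ → G) : reindex (fun k => k) a = a := by
  ext k
  simp [reindex, partialProd]

lemma map_partialProd {G' : Type*} [Group G'] (φ : G →* G') (a : ℕ → G) (n : ℕ) :
    φ (partialProd a n) = partialProd (fun k => φ (a k)) n := by
  induction n with
  | zero => simp [partialProd]
  | succ n ih => simp [partialProd, ih]

lemma map_reindex {G' : Type*} [Group G'] (φ : G →* G') (f : ℕ → ℕ) (a : ℕ → G) (k : ℕ) :
    φ (reindex f a k) = reindex f (fun k => φ (a k)) k := by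
  simp [reindex, map_partialProd]

lemma partialProd_congr {a b : ℕ → G} : ∀ {n : ℕ}, (∀ k < n, a k = b k) →
    partialProd a n = partialProd b n
  | 0, _ => rfl
  | n + 1, h => by
    rw [partialProd, partialProd, partialProd_congr fun k hk => h k (by omega), h n (by omega)]

/-- The `i`-th coface map on indices. -/
def cofaceIdx (i k : ℕ) : ℕ := if k < i then k else k + 1

/-- The `i`-th codegeneracy map on indices. -/
def codegenIdx (i k : ℕ) : ℕ := if k ≤ i then k else k - 1

/-- The cyclic rotation on the indices `0, …, n`. -/
def rotIdx (n k : ℕ) : ℕ := if k = 0 then n else k - 1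

lemma reindex_cofaceIdx_zero (a : ℕ → G) :
    reindex (cofaceIdx 0) a = fun k => a (k + 1) := by
  ext k
  simp [reindex, cofaceIdx, partialProd, mul_assoc]

lemma reindex_of_succ (f g : ℕ → ℕ) (h : ∀ k, g (k + 1) = f k + 1) (a : ℕ → G) (k : ℕ) :
    reindex g a (k + 1) = reindex f (fun k => a (k + 1)) k := by
  simp only [reindex, h, partialProd_succ']
  group

lemma reindex_cofaceIdx_succ (i : ℕ) (a : ℕ → G) (k : ℕ) :
    reindex (cofaceIdx (i + 1)) a (k + 1) = reindex (cofaceIdx i) (fun k => a (k + 1)) k :=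
  reindex_of_succ _ _ (fun k => by simp only [cofaceIdx]; split_ifs <;> omega) a k

lemma reindex_codegenIdx_succ (i : ℕ) (a : ℕ → G) (k : ℕ) :
    reindex (codegenIdx (i + 1)) a (k + 1) = reindex (codegenIdx i) (fun k => a (k + 1)) k :=
  reindex_of_succ _ _ (fun k => by simp only [codegenIdx]; split_ifs <;> omega) a k

end PartialProducts

/-! ### The structure maps computed on points -/

section Structure

variable {C : Type u} [Category.{v} C] [MonoidalCategory C] [SymmetricCategory C]
variable {H R : C} [HopfObj H] [IsCommMonObj H] [MonObj R] [IsCommMonObj R]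

lemma one_insert_lift {X : C} (f : H ⟶ R) (hf : η[H] ≫ f = η[R]) (g : X ⟶ R) :
    ((λ_ X).inv ≫ η[H] ▷ X) ≫ (f ⊗ₘ g) ≫ μ[R] = g := by
  rw [Category.assoc, whiskerRight_comp_tensorHom_assoc, hf, MonObj.one_mul_hom,
    Iso.inv_hom_id_assoc]

/-- Omitting the vertex $i$ drops $a_0$ for $i=0$, drops $a_n$ for $i=n+1$, and otherwise merges
$a_{i-1}$ and $a_i$ into their product. The unit and $\Delta$ do exactly this on points. -/
lemma coface_lift : ∀ (n i : ℕ) (_ : i ≤ n + 1) (a : ℕ → Points H R),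
    coface H η[H] η[H] n i ≫ lift (n + 1) a = lift n (reindex (cofaceIdx i) a)
  | n, 0, _, a => by
    rw [reindex_cofaceIdx_zero]
    cases n <;> exact one_insert_lift _ (IsMonHom.one_hom _) _
  | 0, _ + 1, _, a => one_insert_lift _ (IsMonHom.one_hom _) _
  | n + 1, 1, _, a => by
    have h : (reindex (cofaceIdx 1) a 0).hom = Δ[H] ≫ ((a 0).hom ⊗ₘ (a 1).hom) ≫ μ[R] := by
      simp [reindex, cofaceIdx, partialProd, Points.mul_hom]
    change (Δ[H] ▷ tpow H n ≫ (α_ H H (tpow H n)).hom) ≫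
      ((a 0).hom ⊗ₘ (((a 1).hom ⊗ₘ lift n fun k => a (k + 1 + 1)) ≫ μ[R])) ≫ μ[R] =
      ((reindex (cofaceIdx 1) a 0).hom ⊗ₘ
        lift n fun k => reindex (cofaceIdx 1) a (k + 1)) ≫ μ[R]
    simp only [reindex_cofaceIdx_succ, reindex_cofaceIdx_zero, h]
    simp only [mon_tauto]
  | n + 1, i + 2, h, a => by
    have ih := coface_lift n (i + 1) (by omega) fun k => a (k + 1)
    have h0 : reindex (cofaceIdx (i + 2)) a 0 = a 0 := by
      simp [reindex, cofaceIdx, partialProd]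
    change H ◁ coface H η[H] η[H] n (i + 1) ≫
      ((a 0).hom ⊗ₘ lift (n + 1) fun k => a (k + 1)) ≫ μ[R] =
      ((reindex (cofaceIdx (i + 2)) a 0).hom ⊗ₘ
        lift n fun k => reindex (cofaceIdx (i + 2)) a (k + 1)) ≫ μ[R]
    rw [whiskerLeft_comp_tensorHom_assoc, ih, h0]
    simp only [reindex_cofaceIdx_succ (i + 1)]

lemma codegen_lift : ∀ (n i : ℕ) (_ : i ≤ n) (a : ℕ → Points H R),
    codegen H n i ≫ lift n a = lift (n + 1) (reindex (codegenIdx i) a)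
  | n, 0, _, a => by
    have h0 : (reindex (codegenIdx 0) a 0) = 1 := by
      simp [reindex, codegenIdx, partialProd]
    have h1 : (fun k => reindex (codegenIdx 0) a (k + 1)) = a := by
      ext k
      simp [reindex, codegenIdx, partialProd]
    have e : lift (n + 1) (reindex (codegenIdx 0) a) =
        ((ε[H] ≫ η[R]) ⊗ₘ lift n a) ≫ μ[R] := by
      rw [lift, h0, h1]
      rfl
    have e' : codegen H n 0 = ε[H] ▷ tpow H n ≫ (λ_ (tpow H n)).hom := by cases n <;> rfl
    rw [e, e']
    change (ε[H] ▷ tpow H n ≫ (λ_ (tpow H n)).hom) ≫ lift n a = _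
    rw [Category.assoc (ε[H] ▷ tpow H n) (λ_ (tpow H n)).hom (lift n a), ← MonObj.one_mul_hom, whiskerRight_comp_tensorHom_assoc]
  | n + 1, i + 1, h, a => by
    have ih := codegen_lift n i (by omega) fun k => a (k + 1)
    have h0 : reindex (codegenIdx (i + 1)) a 0 = a 0 := by
      simp [reindex, codegenIdx, partialProd]
    change H ◁ codegen H n i ≫ ((a 0).hom ⊗ₘ lift n fun k => a (k + 1)) ≫ μ[R] =
      ((reindex (codegenIdx (i + 1)) a 0).hom ⊗ₘ
        lift (n + 1) fun k => reindex (codegenIdx (i + 1)) a (k + 1)) ≫ μ[R]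
    rw [whiskerLeft_comp_tensorHom_assoc, ih, h0]
    simp only [reindex_codegenIdx_succ]

/-- Iterated convolution is the product $a_0\cdots a_{n-1}$ in the group of points. -/
lemma iterComul_lift : ∀ (n : ℕ) (a : ℕ → Points H R),
    iterComul H n ≫ lift n a = (partialProd a n).hom
  | 0, _ => rfl
  | n + 1, a => by
    have ih := iterComul_lift n fun k => a (k + 1)
    rw [partialProd_succ', Points.mul_hom, ← ih]
    change (Δ[H] ≫ H ◁ iterComul H n) ≫ ((a 0).hom ⊗ₘ lift n fun k => a (k + 1)) ≫ μ[R] = _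
    rw [Category.assoc, whiskerLeft_comp_tensorHom_assoc]

lemma twistedAntipode_counit (H : C) [HopfObj H] : twistedAntipode H ε[H] = 𝒮[H] := by
  simp [twistedAntipode]

/-- For positive $n$, rotating the vertices sends $(a_0,\dots,a_{n-1})$ to $((a_0\cdots
a_{n-1})^{-1},a_0,\dots,a_{n-2})$. The factor $\Delta^{n-1}S$ yields the first entry and
$1_{H^{n-1}}\otimes\eta$ the others. -/
lemma cyclicOp_lift (n : ℕ) (a : ℕ → Points H R) :
    cyclicOp H ε[H] η[H] n ≫ lift n a = lift n (reindex (rotIdx n) a) := by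
  cases n with
  | zero => exact Category.id_comp _
  | succ n =>
    have e : ∀ f : H ⟶ tpow H (n + 1), ∀ g : tpow H n ⟶ tpow H (n + 1),
        ((f ⊗ₘ g) ≫ μ[tpow H (n + 1)]) ≫ lift (n + 1) a =
          ((f ≫ lift (n + 1) a) ⊗ₘ (g ≫ lift (n + 1) a)) ≫ μ[R] := fun f g => by simp
    have h0 : (reindex (rotIdx (n + 1)) a 0) = (partialProd a (n + 1))⁻¹ := by
      simp [reindex, rotIdx, partialProd]
    have h1 : (fun k => reindex (rotIdx (n + 1)) a (k + 1)) = a := by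
      ext k
      simp [reindex, rotIdx, partialProd]
    -- Omitting the last vertex changes the sequence only from index `n` on, which `lift n` does not
    -- see.
    have h2 : lift n (reindex (cofaceIdx (n + 1)) a) = lift n a := lift_congr n fun k hk => by
      have h3 : k < n + 1 := by omega
      simp [reindex, cofaceIdx, hk, h3, partialProd]
    rw [cyclicOp, mulPow_eq]
    refine (e _ _).trans ?_
    rw [coface_lift n (n + 1) le_rfl, Category.assoc, iterComul_lift, twistedAntipode_counit,
      ← Points.inv_hom, ← h0, h2]
    have e' : lift (n + 1) (reindex (rotIdx (n + 1)) a) =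
      ((reindex (rotIdx (n + 1)) a 0).hom ⊗ₘ
        lift n fun k => reindex (rotIdx (n + 1)) a (k + 1)) ≫ μ[R] := rfl
    rw [e', h1]

end Structure
end HopfCyclic

/-! ### The category of finite vertex sets and its tautological cocyclic object -/

namespace HopfCyclic

/-- The category with objects `n : ℕ`, standing for the set `{0, …, n}`, and all maps. -/
def VertexCat : Type := ℕ

namespace VertexCat

instance : Category VertexCat where
  Hom m n := Fin (Nat.succ m) → Fin (Nat.succ n)
  id _ := id
  comp f g := g ∘ f

/-- The natural number `n` as an object. -/
def of (n : ℕ) : VertexCat := n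

/-- The morphism `m ⟶ n` given on vertices by `f`, with values cut off at `n`. -/
def ofIdx (m n : ℕ) (f : ℕ → ℕ) : of m ⟶ of n :=
  fun k : Fin (m + 1) => (⟨min (f k) n, by omega⟩ : Fin (n + 1))

/-- The function on natural numbers underlying a morphism. -/
def toIdx {m n : ℕ} (f : of m ⟶ of n) (k : ℕ) : ℕ :=
  (show Fin (m + 1) → Fin (n + 1) from f) (Fin.ofNat (m + 1) k)

lemma toIdx_le {m n : ℕ} (f : of m ⟶ of n) (k : ℕ) : toIdx f k ≤ n := by
  have := ((show Fin (m + 1) → Fin (n + 1) from f) (Fin.ofNat (m + 1) k)).2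
  unfold toIdx
  omega

lemma toIdx_comp {l m n : ℕ} (f : of l ⟶ of m) (g : of m ⟶ of n) (k : ℕ) :
    toIdx (f ≫ g) k = toIdx g (toIdx f k) := by
  have h : Fin.ofNat (m + 1) (toIdx f k) =
      (show Fin (l + 1) → Fin (m + 1) from f) (Fin.ofNat (l + 1) k) := by
    apply Fin.ext
    exact Nat.mod_eq_of_lt (Nat.lt_succ_of_le (toIdx_le f k))
  conv_rhs => rw [toIdx, h]
  rfl

lemma toIdx_id {n k : ℕ} (hk : k ≤ n) : toIdx (𝟙 (of n)) k = k :=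
  Nat.mod_eq_of_lt (Nat.lt_succ_of_le hk)

lemma toIdx_ofIdx {m n : ℕ} {f : ℕ → ℕ} {k : ℕ} (hk : k ≤ m) (h : f k ≤ n) :
    toIdx (ofIdx m n f) k = f k := by
  change min (f (k % (m + 1))) n = f k
  rw [Nat.mod_eq_of_lt (Nat.lt_succ_of_le hk), min_eq_left h]

lemma hom_ext {m n : ℕ} {f g : of m ⟶ of n} (h : ∀ k ≤ m, toIdx f k = toIdx g k) : f = g := by
  change (show Fin (m + 1) → Fin (n + 1) from f) = g
  funext ⟨k, hk⟩
  have := h k (by omega)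
  have e : Fin.ofNat (m + 1) k = ⟨k, hk⟩ := Fin.ext (Nat.mod_eq_of_lt hk)
  apply Fin.ext
  rwa [toIdx, toIdx, e] at this

lemma ofIdx_congr {m n : ℕ} {f g : ℕ → ℕ} (h : ∀ k ≤ m, f k = g k) :
    ofIdx m n f = ofIdx m n g := by
  change (show Fin (m + 1) → Fin (n + 1) from ofIdx m n f) = _
  funext k
  apply Fin.ext
  have := h k (by omega)
  change min (f k) n = min (g k) n
  rw [this]

lemma ofIdx_comp {l m n : ℕ} {f g : ℕ → ℕ} (h : ∀ k ≤ l, f k ≤ m) :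
    ofIdx l m f ≫ ofIdx m n g = ofIdx l n fun k => g (f k) := by
  change (show Fin (l + 1) → Fin (n + 1) from ofIdx l m f ≫ ofIdx m n g) = _
  funext k
  apply Fin.ext
  have := h k (by omega)
  change min (g (min (f k) m)) n = min (g (f k)) n
  rw [min_eq_left this]

lemma ofIdx_id (n : ℕ) : ofIdx n n (fun k => k) = 𝟙 _ := by
  change (show Fin (n + 1) → Fin (n + 1) from ofIdx n n (fun k => k)) = _
  funext k
  apply Fin.ext
  change min (k : ℕ) n = k
  omega

/-- The tautological cocyclic object. -/
def cocyclic : CocyclicData VertexCat where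
  X := of
  δ n i := ofIdx n (n + 1) (cofaceIdx i)
  σ n i := ofIdx (n + 1) n (codegenIdx i)
  τ n := ofIdx n n (rotIdx n)

lemma cofaceIdx_le {n i k : ℕ} (h : k ≤ n) : cofaceIdx i k ≤ n + 1 := by
  unfold cofaceIdx; split_ifs <;> omega

lemma codegenIdx_le {n i k : ℕ} (hi : i ≤ n) (h : k ≤ n + 1) : codegenIdx i k ≤ n := by
  unfold codegenIdx; split_ifs <;> omega

lemma rotIdx_le {n k : ℕ} (h : k ≤ n) : rotIdx n k ≤ n := by
  unfold rotIdx; split_ifs <;> omega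

lemma iter_rot (n k : ℕ) (hk : k ≤ n + 1) :
    iter (ofIdx n n (rotIdx n)) k = ofIdx n n fun x => if k ≤ x then x - k else x + (n + 1) - k := by
  induction k with
  | zero =>
    rw [iter, ← ofIdx_id]
    exact ofIdx_congr fun k hk => by simp
  | succ k ih =>
    rw [iter, ih (by omega), ofIdx_comp fun x hx => by split_ifs <;> omega]
    refine ofIdx_congr fun x hx => ?_
    unfold rotIdx
    split_ifs <;> omega

/-- Each axiom becomes an equality of piecewise functions on indices. The range bounds ensure that
the cut-off in `ofIdx` never acts at an intermediate stage. -/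
lemma cocyclic_isCocyclic : cocyclic.IsCocyclic where
  δ_δ n i j h1 h2 := by
    simp only [cocyclic]
    rw [ofIdx_comp fun k => cofaceIdx_le, ofIdx_comp fun k => cofaceIdx_le]
    refine ofIdx_congr fun k hk => ?_
    unfold cofaceIdx; grind
  σ_σ n i j h1 h2 := by
    simp only [cocyclic]
    rw [ofIdx_comp fun k => codegenIdx_le (by omega),
      ofIdx_comp fun k => codegenIdx_le (by omega)]
    refine ofIdx_congr fun k hk => ?_
    unfold codegenIdx; grind
  δ_σ_lt n i j h1 h2 := by
    simp only [cocyclic]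
    rw [ofIdx_comp fun k => cofaceIdx_le, ofIdx_comp fun k => codegenIdx_le (by omega)]
    refine ofIdx_congr fun k hk => ?_
    unfold codegenIdx cofaceIdx; grind
  δ_σ_self n i h1 := by
    simp only [cocyclic]
    rw [ofIdx_comp fun k => cofaceIdx_le, ← ofIdx_id]
    refine ofIdx_congr fun k hk => ?_
    unfold codegenIdx cofaceIdx; grind
  δ_σ_succ n i h1 := by
    simp only [cocyclic]
    rw [ofIdx_comp fun k => cofaceIdx_le, ← ofIdx_id]
    refine ofIdx_congr fun k hk => ?_
    unfold codegenIdx cofaceIdx; grind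
  δ_σ_gt n i j h1 h2 := by
    simp only [cocyclic]
    rw [ofIdx_comp fun k => cofaceIdx_le, ofIdx_comp fun k => codegenIdx_le (by omega)]
    refine ofIdx_congr fun k hk => ?_
    unfold codegenIdx cofaceIdx; grind
  δ_zero_τ n := by
    simp only [cocyclic]
    rw [ofIdx_comp fun k => cofaceIdx_le]
    refine ofIdx_congr fun k hk => ?_
    unfold rotIdx cofaceIdx; grind
  δ_succ_τ n i h1 := by
    simp only [cocyclic]
    rw [ofIdx_comp fun k => cofaceIdx_le, ofIdx_comp fun k => rotIdx_le]
    refine ofIdx_congr fun k hk => ?_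
    unfold rotIdx cofaceIdx; grind
  σ_zero_τ n := by
    simp only [cocyclic]
    rw [ofIdx_comp fun k => codegenIdx_le (by omega), ofIdx_comp fun k => rotIdx_le,
      ofIdx_comp fun k => rotIdx_le]
    refine ofIdx_congr fun k hk => ?_
    unfold rotIdx codegenIdx; grind
  σ_succ_τ n i h1 := by
    simp only [cocyclic]
    rw [ofIdx_comp fun k => codegenIdx_le (by omega), ofIdx_comp fun k => rotIdx_le]
    refine ofIdx_congr fun k hk => ?_
    unfold rotIdx codegenIdx; grind
  τ_pow n := by
    simp only [cocyclic]
    rw [iter_rot n (n + 1) le_rfl, ← ofIdx_id]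
    exact ofIdx_congr fun k hk => by split_ifs <;> omega

end VertexCat

/-! ### Transport of cocyclic objects along functors -/

section Transport

variable {C : Type u} [Category.{v} C] {E : Type u'} [Category.{v'} E]

/-- The image of cocyclic data under a functor. -/
def CocyclicData.map (F : C ⥤ E) (D : CocyclicData C) : CocyclicData E where
  X n := F.obj (D.X n)
  δ n i := F.map (D.δ n i)
  σ n i := F.map (D.σ n i)
  τ n := F.map (D.τ n)

lemma map_iter (F : C ⥤ E) {A : C} (f : A ⟶ A) (k : ℕ) :
    F.map (iter f k) = iter (F.map f) k := by
  induction k with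
  | zero => simp [iter]
  | succ k ih => simp [iter, ih]

lemma CocyclicData.IsCocyclic.map (F : C ⥤ E) {D : CocyclicData C} (h : D.IsCocyclic) :
    (D.map F).IsCocyclic where
  δ_δ n i j h1 h2 := by
    simpa [CocyclicData.map] using congrArg F.map (h.δ_δ n i j h1 h2)
  σ_σ n i j h1 h2 := by
    simpa [CocyclicData.map] using congrArg F.map (h.σ_σ n i j h1 h2)
  δ_σ_lt n i j h1 h2 := by
    simpa [CocyclicData.map] using congrArg F.map (h.δ_σ_lt n i j h1 h2)
  δ_σ_self n i h1 := by
    simpa [CocyclicData.map] using congrArg F.map (h.δ_σ_self n i h1)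
  δ_σ_succ n i h1 := by
    simpa [CocyclicData.map] using congrArg F.map (h.δ_σ_succ n i h1)
  δ_σ_gt n i j h1 h2 := by
    simpa [CocyclicData.map] using congrArg F.map (h.δ_σ_gt n i j h1 h2)
  δ_zero_τ n := by
    simpa [CocyclicData.map] using congrArg F.map (h.δ_zero_τ n)
  δ_succ_τ n i h1 := by
    simpa [CocyclicData.map] using congrArg F.map (h.δ_succ_τ n i h1)
  σ_zero_τ n := by
    simpa [CocyclicData.map] using congrArg F.map (h.σ_zero_τ n)
  σ_succ_τ n i h1 := by
    simpa [CocyclicData.map] using congrArg F.map (h.σ_succ_τ n i h1)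
  τ_pow n := by
    simpa [CocyclicData.map, map_iter] using congrArg F.map (h.τ_pow n)

/-- Being a cocyclic object only depends on the cofaces and codegeneracies in the relevant range. -/
lemma CocyclicData.IsCocyclic.congr {X : ℕ → C} {δ δ' : ∀ n : ℕ, ℕ → (X n ⟶ X (n + 1))}
    {σ σ' : ∀ n : ℕ, ℕ → (X (n + 1) ⟶ X n)} {τ τ' : ∀ n : ℕ, X n ⟶ X n}
    (h : CocyclicData.IsCocyclic ⟨X, δ, σ, τ⟩) (hδ : ∀ n i, i ≤ n + 1 → δ' n i = δ n i)
    (hσ : ∀ n i, i ≤ n → σ' n i = σ n i) (hτ : ∀ n, τ' n = τ n) :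
    CocyclicData.IsCocyclic ⟨X, δ', σ', τ'⟩ where
  δ_δ n i j h1 h2 := by
    simpa (disch := omega) only [hδ] using h.δ_δ n i j h1 h2
  σ_σ n i j h1 h2 := by
    simpa (disch := omega) only [hσ] using h.σ_σ n i j h1 h2
  δ_σ_lt n i j h1 h2 := by
    simpa (disch := omega) only [hδ, hσ] using h.δ_σ_lt n i j h1 h2
  δ_σ_self n i h1 := by
    simpa (disch := omega) only [hδ, hσ] using h.δ_σ_self n i h1
  δ_σ_succ n i h1 := by
    simpa (disch := omega) only [hδ, hσ] using h.δ_σ_succ n i h1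
  δ_σ_gt n i j h1 h2 := by
    simpa (disch := omega) only [hδ, hσ] using h.δ_σ_gt n i j h1 h2
  δ_zero_τ n := by
    simpa (disch := omega) only [hδ, hτ] using h.δ_zero_τ n
  δ_succ_τ n i h1 := by
    simpa (disch := omega) only [hδ, hτ] using h.δ_succ_τ n i h1
  σ_zero_τ n := by
    simpa (disch := omega) only [hσ, hτ] using h.σ_zero_τ n
  σ_succ_τ n i h1 := by
    simpa (disch := omega) only [hσ, hτ] using h.σ_succ_τ n i h1
  τ_pow n := by
    simpa (disch := omega) only [hτ] using h.τ_pow n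

end Transport

/-! ### The functor from vertex sets to tensor powers, and the cocyclic object of a Hopf algebra -/

section VertexFunctor

variable {C : Type u} [Category.{v} C] [MonoidalCategory C] [SymmetricCategory C]
variable (H : C) {R : C} [HopfObj H] [IsCommMonObj H] [MonObj R] [IsCommMonObj R]

variable {H} in
-- Universality of the tautological tuple: together with `lift_taut` it says that $H^n$ represents
-- $n$-tuples of points.
lemma taut_push_lift : ∀ (n : ℕ) (a : ℕ → Points H R) (k : ℕ), k < n →
    (taut H n k).push (lift n a) = a k
  | n + 1, a, 0, _ => by
    refine Points.ext ?_
    change ((ρ_ H).inv ≫ H ◁ η[tpow H n]) ≫ ((a 0).hom ⊗ₘ lift n fun k => a (k + 1)) ≫ μ[R] = _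
    rw [Category.assoc, whiskerLeft_comp_tensorHom_assoc, IsMonHom.one_hom, MonObj.mul_one_hom,
      Iso.inv_hom_id_assoc]
  | n + 1, a, k + 1, h => by
    refine Points.ext ?_
    change ((taut H n k).hom ≫ (λ_ (tpow H n)).inv ≫ η[H] ▷ tpow H n) ≫
      ((a 0).hom ⊗ₘ lift n fun k => a (k + 1)) ≫ μ[R] = _
    rw [Category.assoc, one_insert_lift _ (IsMonHom.one_hom _)]
    exact congrArg Points.hom (taut_push_lift n (fun k => a (k + 1)) k (by omega))

variable {H} in
lemma lift_reindex_congr {n : ℕ} {f g : ℕ → ℕ} (a : ℕ → Points H R) (h : ∀ k ≤ n, f k = g k) :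
    lift n (reindex f a) = lift n (reindex g a) :=
  lift_congr n fun k hk => by
    rw [reindex, reindex, h k (by omega), h (k + 1) (by omega)]

/-- The morphism `H^m ⟶ H^n` attached to a map `{0, …, m} → {0, …, n}`. -/
def vertexMap {m n : ℕ} (f : VertexCat.of m ⟶ VertexCat.of n) : tpow H m ⟶ tpow H n :=
  lift m (reindex (VertexCat.toIdx f) (taut H n))

variable {H} in
lemma vertexMap_lift {m n : ℕ} (f : VertexCat.of m ⟶ VertexCat.of n) (a : ℕ → Points H R) :
    vertexMap H f ≫ lift n a = lift m (reindex (VertexCat.toIdx f) a) := by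
  rw [vertexMap, lift_comp]
  refine lift_congr m fun k hk => ?_
  -- Pushing forward is a group homomorphism, so it commutes with reindexing. The values of `toIdx
  -- f` are at most `n`, hence only the first `n` tautological points enter.
  refine (map_reindex (G := Points H (tpow H n)) (G' := Points H R) (Points.pushHom (lift n a)) _ _ k).trans ?_
  have h : ∀ l, partialProd (fun k => (taut H n k).push (lift n a)) (VertexCat.toIdx f l) =
      partialProd a (VertexCat.toIdx f l) := fun l => partialProd_congr fun j hj =>
    taut_push_lift n a j (hj.trans_le (VertexCat.toIdx_le f l))
  exact congrArg₂ (fun x y => x⁻¹ * y) (h k) (h (k + 1))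

/-- The functor `n ↦ H^n` on the category of nonempty finite sets: the affine group scheme
analogue of `X ↦ Map(X, G) / G`. -/
def vertexFunctor : VertexCat ⥤ C where
  obj n := tpow H n
  map {m n} f := vertexMap (m := m) (n := n) H f
  map_id := fun (n : ℕ) => by
    have h : lift (R := tpow H n) n (reindex (fun k => k) (taut H n)) = 𝟙 _ := by
      rw [reindex_id, lift_taut]
    exact (lift_reindex_congr _ fun k hk => VertexCat.toIdx_id hk).trans h
  map_comp := fun {l m n : ℕ} f g => by
    refine Eq.trans ?_ (vertexMap_lift (R := tpow H n) f _).symm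
    rw [reindex_reindex]
    exact lift_reindex_congr _ fun k _ => VertexCat.toIdx_comp (l := l) (m := m) (n := n) f g k

/-- By `lift_taut`, the effect on the tautological tuple recovers `φ` itself; `hf` makes the cut-off
in `ofIdx` harmless. -/
lemma eq_vertexMap_ofIdx {m n : ℕ} (φ : tpow H m ⟶ tpow H n) {f : ℕ → ℕ}
    (hf : ∀ k ≤ m, f k ≤ n)
    (hφ : φ ≫ lift n (taut H n) = lift m (reindex f (taut H n))) :
    φ = vertexMap H (VertexCat.ofIdx m n f) := by
  rw [lift_taut, Category.comp_id] at hφ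
  rw [hφ]
  exact lift_reindex_congr _ fun k hk => (VertexCat.toIdx_ofIdx hk (hf k hk)).symm

lemma coface_eq_vertexMap (n i : ℕ) (hi : i ≤ n + 1) :
    coface H η[H] η[H] n i = vertexMap H (VertexCat.cocyclic.δ n i) :=
  eq_vertexMap_ofIdx H _ (fun _ => VertexCat.cofaceIdx_le) (coface_lift n i hi _)

lemma codegen_eq_vertexMap (n i : ℕ) (hi : i ≤ n) :
    codegen H n i = vertexMap H (VertexCat.cocyclic.σ n i) :=
  eq_vertexMap_ofIdx H _ (fun _ => VertexCat.codegenIdx_le hi) (codegen_lift n i hi _)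

lemma cyclicOp_eq_vertexMap (n : ℕ) :
    cyclicOp H ε[H] η[H] n = vertexMap H (VertexCat.cocyclic.τ n) :=
  eq_vertexMap_ofIdx H _ (fun _ => VertexCat.rotIdx_le) (cyclicOp_lift n _)

lemma hopfCocyclicData_isCocyclic : (hopfCocyclicData H ε[H] η[H]).IsCocyclic :=
  CocyclicData.IsCocyclic.congr (VertexCat.cocyclic_isCocyclic.map (vertexFunctor H))
    (coface_eq_vertexMap H) (codegen_eq_vertexMap H) (cyclicOp_eq_vertexMap H)

lemma isModularPairInInvolution : IsModularPairInInvolution H ε[H] η[H] where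
  character := ⟨by rw [BimonObj.mul_counit]; rfl, BimonObj.one_counit H⟩
  cocharacter := isCocharacter_one H
  modular := BimonObj.one_counit H
  involution := by
    rw [twistedAntipode_counit, HopfObj.antipode_antipode H (IsCommMonObj.mul_comm H),
      HopfObj.one_antipode, ← tensorHom_id, ← tensorHom_id, tensorHom_comp_tensorHom_assoc,
      tensorHom_comp_tensorHom_assoc, Category.assoc, MonObj.one_mul_hom,
      Iso.inv_hom_id_assoc, Category.comp_id, Category.id_comp, MonObj.mul_one_hom]
    simp

end VertexFunctor
end HopfCyclic

noncomputable section

namespace HopfCyclic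

/-! ### Morphisms from the Hochschild complex to the total complex, in components -/

section Trivialization

variable {C : Type u} [Category.{v} C] [Preadditive C]

/-- A family `ρ n q : X n ⟶ X q` that, when the target is placed in column `n - q` of the cyclic
bicomplex, is a morphism of complexes from `(X, b)` to the total complex, with the identity in
column `0`. -/
structure CocyclicData.IsTrivialization (D : CocyclicData C) (ρ : ∀ n q : ℕ, D.X n ⟶ D.X q) :
    Prop where
  self : ∀ n, ρ n n = 𝟙 _
  eq_zero : ∀ n q, n < q → ρ n q = 0
  b_comp_zero : ∀ n, D.b n ≫ ρ (n + 1) 0 = ρ n 0 ≫ D.horiz n 0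
  b_comp_succ : ∀ n q, D.b n ≫ ρ (n + 1) (q + 1) =
    ρ n (q + 1) ≫ D.horiz (n - (q + 1)) (q + 1) +
      (-1 : ℤ) ^ (n - q) • (ρ n q ≫ D.vert (n - q) q)

/-- The `X q`-component of the total differential applied to a family of morphisms `x q : A ⟶ X q`
into the entries of total degree `n`. -/
def CocyclicData.totalD (D : CocyclicData C) {A : C} (n : ℕ) (x : ∀ q : ℕ, A ⟶ D.X q) :
    ∀ q : ℕ, A ⟶ D.X q
  | 0 => x 0 ≫ D.horiz n 0
  | q + 1 => x (q + 1) ≫ D.horiz (n - (q + 1)) (q + 1) +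
      (-1 : ℤ) ^ (n - q) • (x q ≫ D.vert (n - q) q)

lemma CocyclicData.comp_totalD (D : CocyclicData C) {A B : C} (f : B ⟶ A) (n : ℕ)
    (x : ∀ q : ℕ, A ⟶ D.X q) (q : ℕ) :
    f ≫ D.totalD n x q = D.totalD n (fun q => f ≫ x q) q := by
  cases q <;> simp [CocyclicData.totalD]

/-- This is $d^2=0$ in the total complex, expressed in components so that it applies in a
preadditive category without biproducts. -/
lemma CocyclicData.IsCocyclic.totalD_totalD {D : CocyclicData C} (h : D.IsCocyclic) {A : C}
    (n : ℕ) (x : ∀ q : ℕ, A ⟶ D.X q) (hx : ∀ q, n < q → x q = 0) (q : ℕ) (hq : q ≤ n + 1) :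
    D.totalD (n + 1) (D.totalD n x) q = 0 := by
  -- With truncated subtraction, $n+1-q=(n-q)+1$ fails at $q=n+1$; there `x q` vanishes instead.
  have hh : ∀ q ≤ n + 1, x q ≫ D.horiz (n - q) q ≫ D.horiz (n + 1 - q) q = 0 := by
    intro q hq
    by_cases hqn : q ≤ n
    · rw [show n + 1 - q = n - q + 1 by omega, h.horiz_horiz, comp_zero]
    · rw [hx q (by omega), zero_comp]
  cases q with
  | zero => simpa [totalD] using hh 0 (by omega)
  | succ q =>
    have h1 := hh (q + 1) hq
    rw [show n + 1 - (q + 1) = n - q by omega] at h1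
    have h2 := h.horiz_vert (n - q) q
    cases q with
    | zero =>
      simp only [Nat.sub_zero, zero_add] at h1 h2
      simp only [totalD, Nat.sub_zero, zero_add, Preadditive.add_comp, Category.assoc, h1,
        Nat.add_sub_cancel, Preadditive.zsmul_comp, h2]
      rw [pow_succ]
      simp
    | succ q =>
      simp only [totalD, Preadditive.add_comp, Category.assoc, h1, Preadditive.zsmul_comp,
        show n + 1 - (q + 1 + 1) = n - (q + 1) by omega,
        show n + 1 - (q + 1) = n - (q + 1) + 1 by omega, h2]
      rw [show n - q = n - (q + 1) + 1 by omega, h.vert_vert, pow_succ]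
      simp

end Trivialization

/-! ### Linear extension of functors to formal integral combinations -/

section Free

variable {C : Type u} [Category.{v} C]

/-- Additive extension of a map to formal integral combinations of morphisms. -/
def freeHomLift {X Y : C} {A : Type*} [AddCommGroup A] (φ : (X ⟶ Y) → A) :
    ((Free.embedding ℤ C).obj X ⟶ (Free.embedding ℤ C).obj Y) →+ A :=
  Finsupp.liftAddHom (M := ℤ) fun f => zmultiplesHom A (φ f)

lemma freeHomLift_embedding {X Y : C} {A : Type*} [AddCommGroup A] (φ : (X ⟶ Y) → A)
    (f : X ⟶ Y) : freeHomLift φ ((Free.embedding ℤ C).map f) = φ f :=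
  (Finsupp.liftAddHom_apply_single (M := ℤ) _ f 1).trans (one_zsmul _)

lemma free_induction {X Y : C}
    {P : ((Free.embedding ℤ C).obj X ⟶ (Free.embedding ℤ C).obj Y) → Prop}
    (hadd : ∀ x y, P x → P y → P (x + y)) (hneg : ∀ x, P x → P (-x)) (h0 : P 0)
    (h1 : ∀ f, P ((Free.embedding ℤ C).map f))
    (x : (Free.embedding ℤ C).obj X ⟶ (Free.embedding ℤ C).obj Y) : P x := by
  have hn : ∀ f, ∀ n : ℕ, P (Finsupp.single f (n : ℤ)) := by
    intro f n
    induction n with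
    | zero =>
      have : Finsupp.single f ((0 : ℕ) : ℤ) = 0 := by simp
      rw [this]
      exact h0
    | succ n ih =>
      have : Finsupp.single f ((n + 1 : ℕ) : ℤ) = Finsupp.single f (n : ℤ) + Finsupp.single f 1 := by
        rw [← Finsupp.single_add]
        simp
      rw [this]
      exact hadd _ _ ih (h1 f)
  induction x using Finsupp.induction_linear with
  | zero => exact h0
  | add x y hx hy => exact hadd x y hx hy
  | single f r =>
    obtain ⟨n, rfl | rfl⟩ := r.eq_nat_or_neg
    · exact hn f n
    · rw [Finsupp.single_neg]
      exact hneg _ (hn f n)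

lemma freeHomLift_comp {E : Type u'} [Category.{v'} E] [Preadditive E] (F : C ⥤ E) {X Y Z : C}
    (f : (Free.embedding ℤ C).obj X ⟶ (Free.embedding ℤ C).obj Y)
    (g : (Free.embedding ℤ C).obj Y ⟶ (Free.embedding ℤ C).obj Z) :
    freeHomLift (fun h : X ⟶ Z => F.map h) (f ≫ g) =
      freeHomLift (fun h : X ⟶ Y => F.map h) f ≫ freeHomLift (fun h : Y ⟶ Z => F.map h) g := by
  induction f using free_induction with
  | hadd x y hx hy => rw [Preadditive.add_comp, map_add, map_add, hx, hy, Preadditive.add_comp]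
  | hneg x hx => rw [Preadditive.neg_comp, map_neg, map_neg, hx, Preadditive.neg_comp]
  | h0 => rw [zero_comp, map_zero, map_zero, zero_comp]
  | h1 f =>
    induction g using free_induction with
    | hadd x y hx hy => rw [Preadditive.comp_add, map_add, map_add, hx, hy, Preadditive.comp_add]
    | hneg x hx => rw [Preadditive.comp_neg, map_neg, map_neg, hx, Preadditive.comp_neg]
    | h0 => rw [comp_zero, map_zero, map_zero, comp_zero]
    | h1 g =>
      rw [← Functor.map_comp, freeHomLift_embedding, freeHomLift_embedding, freeHomLift_embedding,
        F.map_comp]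

/-- The linear extension of a functor to the preadditive category of formal integral combinations
of morphisms. -/
def freeLift {E : Type u'} [Category.{v'} E] [Preadditive E] (F : C ⥤ E) : Free ℤ C ⥤ E where
  obj X := F.obj X
  map := fun {X Y : C} => freeHomLift (X := X) (Y := Y) fun h => F.map h
  map_id := fun X : C => (freeHomLift_embedding (X := X) (Y := X) (fun h => F.map h) (𝟙 X)).trans (F.map_id X)
  map_comp f g := freeHomLift_comp F f g

instance freeLift_additive {E : Type u'} [Category.{v'} E] [Preadditive E] (F : C ⥤ E) :
    (freeLift F).Additive where
  map_add := fun {X Y : C} f g =>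
    (freeHomLift (X := X) (Y := Y) fun h => F.map h).map_add' f g

end Free

/-! ### Coning off and the universal trivialization -/

namespace VertexCat

/-- The cone with apex `0` over a simplex. -/
def cone {m n : ℕ} (f : of m ⟶ of n) : of (m + 1) ⟶ of n :=
  ofIdx (m + 1) n fun k => if k = 0 then 0 else toIdx f (k - 1)

lemma toIdx_cone {m n : ℕ} (f : of m ⟶ of n) {k : ℕ} (hk : k ≤ m + 1) :
    toIdx (cone f) k = if k = 0 then 0 else toIdx f (k - 1) :=
  toIdx_ofIdx hk (by split_ifs; exacts [Nat.zero_le _, toIdx_le _ _])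

lemma δ_zero_comp_cone {m n : ℕ} (f : of m ⟶ of n) :
    ofIdx m (m + 1) (cofaceIdx 0) ≫ cone f = f :=
  hom_ext fun k hk => by
    rw [toIdx_comp, toIdx_ofIdx hk (cofaceIdx_le hk), toIdx_cone f (cofaceIdx_le hk)]
    simp [cofaceIdx]

lemma δ_succ_comp_cone {m n : ℕ} (i : ℕ) (f : of (m + 1) ⟶ of n) :
    ofIdx (m + 1) (m + 2) (cofaceIdx (i + 1)) ≫ cone f =
      cone (ofIdx m (m + 1) (cofaceIdx i) ≫ f) :=
  hom_ext fun k hk => by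
    rw [toIdx_comp, toIdx_ofIdx hk (cofaceIdx_le hk), toIdx_cone f (cofaceIdx_le hk),
      toIdx_cone _ hk]
    cases k with
    | zero => simp [cofaceIdx]
    | succ k =>
      have hk' : k ≤ m := by omega
      rw [Nat.add_sub_cancel, toIdx_comp, toIdx_ofIdx hk' (cofaceIdx_le hk')]
      simp only [cofaceIdx]
      split_ifs <;> first | rfl | omega

/-- The universal cocyclic object in a preadditive category of formal combinations of vertex
maps. -/
def freeCocyclic : CocyclicData (Free ℤ VertexCat) :=
  cocyclic.map (Free.embedding ℤ VertexCat)

lemma freeCocyclic_isCocyclic : freeCocyclic.IsCocyclic :=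
  cocyclic_isCocyclic.map _

/-- The linear extension of the cone operator. -/
def freeCone (m n : ℕ) :
    (freeCocyclic.X m ⟶ freeCocyclic.X n) →+ (freeCocyclic.X (m + 1) ⟶ freeCocyclic.X n) :=
  freeHomLift (X := of m) (Y := of n) fun f => (Free.embedding ℤ VertexCat).map (cone f)

lemma freeCone_embedding {m n : ℕ} (f : of m ⟶ of n) :
    freeCone m n ((Free.embedding ℤ VertexCat).map f) =
      (Free.embedding ℤ VertexCat).map (cone f) :=
  freeHomLift_embedding _ f

lemma freeδ_zero_comp_freeCone {m n : ℕ} (x : freeCocyclic.X m ⟶ freeCocyclic.X n) :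
    freeCocyclic.δ m 0 ≫ freeCone m n x = x := by
  induction x using free_induction (X := of m) (Y := of n) with
  | hadd x y hx hy => 
    refine (congrArg _ (map_add (freeCone m n) x y)).trans ?_
    exact (Preadditive.comp_add _ _ _ _ _ _).trans (congrArg₂ _ hx hy)
  | hneg x hx =>
    refine (congrArg _ (map_neg (freeCone m n) x)).trans ?_
    exact (Preadditive.comp_neg _ _).trans (congrArg _ hx)
  | h0 => exact (congrArg _ (map_zero (freeCone m n))).trans comp_zero
  | h1 f =>
    refine (congrArg _ (freeCone_embedding f)).trans ?_
    exact (Functor.map_comp (Free.embedding ℤ VertexCat) _ _).symm.trans (congrArg _ (δ_zero_comp_cone f))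

lemma freeδ_succ_comp_freeCone {m n : ℕ} (i : ℕ)
    (x : freeCocyclic.X (m + 1) ⟶ freeCocyclic.X n) :
    freeCocyclic.δ (m + 1) (i + 1) ≫ freeCone (m + 1) n x =
      freeCone m n (freeCocyclic.δ m i ≫ x) := by
  let L : (freeCocyclic.X (m + 1) ⟶ freeCocyclic.X n) →+
      (freeCocyclic.X (m + 1) ⟶ freeCocyclic.X n) :=
    (Preadditive.leftComp _ (freeCocyclic.δ (m + 1) (i + 1))).comp (freeCone (m + 1) n)
  let L' : (freeCocyclic.X (m + 1) ⟶ freeCocyclic.X n) →+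
      (freeCocyclic.X (m + 1) ⟶ freeCocyclic.X n) :=
    (freeCone m n).comp (Preadditive.leftComp _ (freeCocyclic.δ m i))
  change L x = L' x
  induction x using free_induction (X := of (m + 1)) (Y := of n) with
  | hadd x y hx hy => exact (map_add L x y).trans ((congrArg₂ _ hx hy).trans (map_add L' x y).symm)
  | hneg x hx => exact (map_neg L x).trans ((congrArg _ hx).trans (map_neg L' x).symm)
  | h0 => exact (map_zero L).trans (map_zero L').symm
  | h1 f =>
    change freeCocyclic.δ (m + 1) (i + 1) ≫ freeCone (m + 1) n _ =
      freeCone m n (freeCocyclic.δ m i ≫ _)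
    refine (congrArg _ (freeCone_embedding f)).trans ?_
    refine (Functor.map_comp (Free.embedding ℤ VertexCat) _ _).symm.trans ?_
    refine (congrArg _ (δ_succ_comp_cone i f)).trans ((freeCone_embedding _).symm.trans ?_)
    exact congrArg _ (Functor.map_comp (Free.embedding ℤ VertexCat) _ _)

/-- The face of a cone opposite its apex is the base, and the other faces are cones over the faces
of the base, with the opposite sign. So the cone is a contracting homotopy for precomposition with
`b` in positive degrees. -/
lemma b_comp_freeCone {m n : ℕ} (x : freeCocyclic.X (m + 1) ⟶ freeCocyclic.X n) :
    freeCocyclic.b (m + 1) ≫ freeCone (m + 1) n x = x - freeCone m n (freeCocyclic.b m ≫ x) := by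
  have h : ∀ i, ((-1 : ℤ) ^ (i + 1) • freeCocyclic.δ (m + 1) (i + 1)) ≫ freeCone (m + 1) n x =
      -freeCone m n (((-1 : ℤ) ^ i • freeCocyclic.δ m i) ≫ x) := by
    intro i
    rw [Preadditive.zsmul_comp, freeδ_succ_comp_freeCone, Preadditive.zsmul_comp, map_zsmul,
      pow_succ, mul_neg_one, neg_smul]
  rw [CocyclicData.b, altSum, Finset.sum_range_succ', Preadditive.add_comp, CocyclicData.b,
    altSum, Preadditive.sum_comp, Preadditive.sum_comp, map_sum, pow_zero, one_smul,
    freeδ_zero_comp_freeCone, Finset.sum_congr rfl fun i _ => h i, Finset.sum_neg_distrib,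
    neg_add_eq_sub]

/-- The universal trivialization, constructed by coning off. -/
def trivialization : ∀ n q : ℕ, freeCocyclic.X n ⟶ freeCocyclic.X q
  | 0, q => if h : q = 0 then eqToHom (by rw [h]) else 0
  | n + 1, q =>
    if h : q = n + 1 then eqToHom (by rw [h])
    -- The component is to solve `b ≫ y = totalD n (trivialization n) q` for `y`; coning off the
    -- right-hand side gives a solution once that side is a cocycle.
    else if q ≤ n then freeCone n q (freeCocyclic.totalD n (trivialization n) q) else 0

lemma trivialization_self (n : ℕ) : trivialization n n = 𝟙 _ := by
  cases n <;> simp [trivialization]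

lemma trivialization_of_lt {n q : ℕ} (h : n < q) : trivialization n q = 0 := by
  cases n with
  | zero => simp [trivialization, h.ne']
  | succ n => simp [trivialization, h.ne', show ¬ q ≤ n by omega]

lemma trivialization_of_le {n q : ℕ} (h : q ≤ n) : trivialization (n + 1) q =
    freeCone n q (freeCocyclic.totalD n (trivialization n) q) := by
  simp [trivialization, show q ≠ n + 1 by omega, h]

lemma totalD_trivialization_succ (n : ℕ) :
    freeCocyclic.totalD n (trivialization n) (n + 1) = freeCocyclic.b n := by
  simp [CocyclicData.totalD, trivialization_self, trivialization_of_lt, CocyclicData.vert]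

lemma totalD_trivialization_of_lt {n q : ℕ} (h : n + 1 < q) :
    freeCocyclic.totalD n (trivialization n) q = 0 := by
  cases q with
  | zero => omega
  | succ q =>
    simp [CocyclicData.totalD, trivialization_of_lt (show n < q + 1 by omega),
      trivialization_of_lt (show n < q by omega)]

/-- Acyclic models. By the cone formula the error is the cone over `b` composed with the right-hand
side; the induction hypothesis rewrites this composite as a double application of the total
differential, which vanishes. In row `n + 1` both sides are `b`, and above it both are zero. -/
lemma b_comp_trivialization (n q : ℕ) : freeCocyclic.b n ≫ trivialization (n + 1) q =
    freeCocyclic.totalD n (trivialization n) q := by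
  induction n generalizing q with
  | zero =>
    rcases Nat.lt_trichotomy q 1 with h | rfl | h
    · obtain rfl : q = 0 := by omega
      -- The cone formula says nothing about vertices, so the induction starts from $1-t_0=0$.
      have h0 : freeCocyclic.totalD 0 (trivialization 0) 0 = 0 := by
        have := freeCocyclic_isCocyclic.t_pow 0
        simp only [iter, Category.id_comp] at this
        simp [CocyclicData.totalD, CocyclicData.horiz, this]
      rw [trivialization_of_le le_rfl, h0, map_zero, comp_zero]
    · rw [trivialization_self, Category.comp_id, totalD_trivialization_succ]
    · rw [trivialization_of_lt h, comp_zero, totalD_trivialization_of_lt h]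
  | succ n ih =>
    rcases Nat.lt_trichotomy q (n + 2) with h | rfl | h
    · rw [trivialization_of_le (by omega), b_comp_freeCone, CocyclicData.comp_totalD]
      simp only [ih]
      rw [freeCocyclic_isCocyclic.totalD_totalD n _ (fun q => trivialization_of_lt) q (by omega),
        map_zero, sub_zero]
    · rw [trivialization_self, Category.comp_id, totalD_trivialization_succ]
    · rw [trivialization_of_lt h, comp_zero, totalD_trivialization_of_lt h]

lemma isTrivialization : freeCocyclic.IsTrivialization trivialization where
  self := trivialization_self
  eq_zero _ _ := trivialization_of_lt
  b_comp_zero n := b_comp_trivialization n 0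
  b_comp_succ n q := b_comp_trivialization n (q + 1)

end VertexCat

/-! ### Transport of trivializations along additive functors -/

section

variable {C : Type u} [Category.{v} C] [Preadditive C] {E : Type u'} [Category.{v'} E]
  [Preadditive E]

section

variable (F : C ⥤ E) [F.Additive] (D : CocyclicData C)

lemma map_altSum {A B : C} (k : ℕ) (f : ℕ → (A ⟶ B)) :
    F.map (altSum k f) = altSum k fun i => F.map (f i) := by
  simp [altSum, Functor.map_sum]

lemma CocyclicData.map_b (n : ℕ) : (D.map F).b n = F.map (D.b n) := (map_altSum F _ _).symm

lemma CocyclicData.map_b' (n : ℕ) : (D.map F).b' n = F.map (D.b' n) := (map_altSum F _ _).symm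

lemma CocyclicData.map_t (n : ℕ) : (D.map F).t n = F.map (D.t n) := (F.map_zsmul).symm

lemma CocyclicData.map_N (n : ℕ) : (D.map F).N n = F.map (D.N n) := by
  simp only [N, Functor.map_sum, map_iter, map_t]
  rfl

lemma CocyclicData.map_vert (p q : ℕ) : (D.map F).vert p q = F.map (D.vert p q) := by
  unfold vert
  split_ifs
  exacts [D.map_b F q, D.map_b' F q]

lemma CocyclicData.map_horiz (p q : ℕ) : (D.map F).horiz p q = F.map (D.horiz p q) := by
  unfold horiz
  split_ifs
  · rw [map_t, F.map_sub, F.map_id]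
    rfl
  · exact D.map_N F q

lemma CocyclicData.IsTrivialization.map {ρ : ∀ n q : ℕ, D.X n ⟶ D.X q}
    (h : D.IsTrivialization ρ) : (D.map F).IsTrivialization fun n q => F.map (ρ n q) where
  self n := by rw [h.self, F.map_id]; rfl
  eq_zero n q hq := by rw [h.eq_zero n q hq, F.map_zero]; rfl
  b_comp_zero n := by
    rw [map_b, map_horiz]
    exact (F.map_comp _ _).symm.trans ((congrArg F.map (h.b_comp_zero n)).trans (F.map_comp _ _))
  b_comp_succ n q := by
    rw [map_b, map_horiz, map_vert]
    refine (F.map_comp _ _).symm.trans ((congrArg F.map (h.b_comp_succ n q)).trans ?_)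
    rw [F.map_add, F.map_zsmul, F.map_comp, F.map_comp]
    rfl

end

lemma CocyclicData.IsTrivialization.congr {X : ℕ → C} {δ δ' : ∀ n : ℕ, ℕ → (X n ⟶ X (n + 1))}
    {σ σ' : ∀ n : ℕ, ℕ → (X (n + 1) ⟶ X n)} {τ τ' : ∀ n : ℕ, X n ⟶ X n}
    {ρ : ∀ n q : ℕ, X n ⟶ X q}
    (h : CocyclicData.IsTrivialization ⟨X, δ, σ, τ⟩ ρ) (hδ : ∀ n i, i ≤ n + 1 → δ' n i = δ n i)
    (hτ : ∀ n, τ' n = τ n) :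
    CocyclicData.IsTrivialization ⟨X, δ', σ', τ'⟩ ρ := by
  have hb : CocyclicData.b ⟨X, δ', σ', τ'⟩ = CocyclicData.b ⟨X, δ, σ, τ⟩ := by
    funext n
    change altSum (n + 2) (δ' n) = altSum (n + 2) (δ n)
    refine Finset.sum_congr rfl fun i hi => ?_
    rw [Finset.mem_range] at hi
    rw [hδ n i (by omega)]
  have hb' : CocyclicData.b' ⟨X, δ', σ', τ'⟩ = CocyclicData.b' ⟨X, δ, σ, τ⟩ := by
    funext n
    change altSum (n + 1) (δ' n) = altSum (n + 1) (δ n)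
    refine Finset.sum_congr rfl fun i hi => ?_
    rw [Finset.mem_range] at hi
    rw [hδ n i (by omega)]
  obtain rfl : τ' = τ := funext hτ
  have hv : CocyclicData.vert ⟨X, δ', σ', τ'⟩ = CocyclicData.vert ⟨X, δ, σ, τ'⟩ := by
    funext p q
    simp only [CocyclicData.vert, hb, hb']
  refine ⟨h.self, h.eq_zero, fun n => ?_, fun n q => ?_⟩
  · rw [hb]
    exact h.b_comp_zero n
  · rw [hb, hv]
    exact h.b_comp_succ n q

end

/-- The linear extension of `vertexFunctor H` carries the universal trivialization to $H$. Its
cofaces agree with those of the Hopf algebra only for $i\le n+1$, which is all that `b` and `b'`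
involve. -/
lemma exists_isTrivialization {C : Type u} [Category.{v} C] [Preadditive C] [MonoidalCategory C]
    [SymmetricCategory C] (H : C) [HopfObj H] [IsCommMonObj H] :
    ∃ ρ, (hopfCocyclicData H ε[H] η[H]).IsTrivialization ρ := by
  have h := VertexCat.isTrivialization.map (freeLift (vertexFunctor H))
  exact ⟨_, CocyclicData.IsTrivialization.congr (X := tpow H)
    (δ := (VertexCat.freeCocyclic.map (freeLift (vertexFunctor H))).δ)
    (σ := (VertexCat.freeCocyclic.map (freeLift (vertexFunctor H))).σ)
    (τ := (VertexCat.freeCocyclic.map (freeLift (vertexFunctor H))).τ) h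
    (fun n i hi => (coface_eq_vertexMap H n i hi).trans (freeHomLift_embedding _ _).symm)
    fun n => (cyclicOp_eq_vertexMap H n).trans (freeHomLift_embedding _ _).symm⟩

end HopfCyclic

end

noncomputable section

namespace HopfCyclic

/-! ### Homological algebra of the splitting -/

section Splitting

open HomologicalComplex

variable {C : Type u} [Category.{v} C] [Abelian C] {J : Type*} {c : ComplexShape J}

/-- If, in each degree, a complex `T` is the direct sum of a quotient complex `K`, a contractible
subquotient `Z` and a subcomplex `S`, and `T ⟶ K` is split by a morphism of complexes, then the
homology of `T` is the direct sum of those of `K` and `S`. -/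
theorem nonempty_homology_iso_of_splitting {T K Z S : HomologicalComplex C c}
    (π : T ⟶ K) (ρ : K ⟶ T) (hρ : ρ ≫ π = 𝟙 K) (i : S ⟶ T) (hi : i ≫ π = 0)
    (j : ∀ n, T.X n ⟶ S.X n) (hij : ∀ n, i.f n ≫ j n = 𝟙 _)
    (ι₀ : ∀ n, K.X n ⟶ T.X n) (ι₁ : ∀ n, Z.X n ⟶ T.X n) (π₁ : ∀ n, T.X n ⟶ Z.X n)
    (hι₁ : ∀ n, ι₁ n ≫ π₁ n = 𝟙 _) (hι₁' : ∀ n, ι₁ n ≫ π.f n = 0)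
    (hi₁ : ∀ n, i.f n ≫ π₁ n = 0)
    (hsum : ∀ n, j n ≫ i.f n + π.f n ≫ ι₀ n + π₁ n ≫ ι₁ n = 𝟙 _)
    (hd : ∀ n m, ∃ θ : K.X n ⟶ Z.X m, T.d n m ≫ π₁ m = π₁ n ≫ Z.d n m + π.f n ≫ θ)
    (hZ : Homotopy (𝟙 Z) 0) (n : J) :
    Nonempty (T.homology n ≅ K.homology n ⊞ S.homology n) := by
  -- The contraction of `Z`, extended to `T` by zero. The resulting null-homotopic `ν` is zero on
  -- `S` and after projection to `K`, and projects to `Z` as `π₁` up to a term factoring through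
  -- `K`.
  let k : ∀ a b, T.X a ⟶ T.X b := fun a b => π₁ a ≫ hZ.hom a b ≫ ι₁ b
  let ν : T ⟶ T := Homotopy.nullHomotopicMap k
  have hν : Homotopy ν 0 := Homotopy.nullHomotopy k fun a b hab => by
    simp only [k]
    rw [hZ.zero a b hab, zero_comp, comp_zero]
  have hνf : ∀ a, ν.f a = T.d a (c.next a) ≫ k (c.next a) a + k a (c.prev a) ≫ T.d (c.prev a) a :=
    fun a => rfl
  have hνπ : ν ≫ π = 0 := by
    ext a
    rw [comp_f, hνf, Preadditive.add_comp, Category.assoc, Category.assoc]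
    simp only [k, Category.assoc, hι₁', comp_zero, ← π.comm, reassoc_of% hι₁', zero_comp, add_zero]
    rfl
  have hiν : i ≫ ν = 0 := by
    ext a
    rw [comp_f, hνf, Preadditive.comp_add, i.comm_assoc]
    simp only [k, Category.assoc, reassoc_of% hi₁, zero_comp, comp_zero, add_zero]
    rfl
  have hνπ₁ : ∀ a, ∃ θ : K.X a ⟶ Z.X a, ν.f a ≫ π₁ a = π₁ a + π.f a ≫ θ := by
    intro a
    obtain ⟨θ, hθ⟩ := hd a (c.next a)
    obtain ⟨θ', hθ'⟩ := hd (c.prev a) a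
    refine ⟨θ ≫ hZ.hom (c.next a) a, ?_⟩
    have e : 𝟙 (Z.X a) = Z.d a (c.next a) ≫ hZ.hom (c.next a) a +
        hZ.hom a (c.prev a) ≫ Z.d (c.prev a) a := by
      have := hZ.comm a
      rw [zero_f_apply, add_zero] at this
      exact this
    rw [hνf, Preadditive.add_comp]
    simp only [k, Category.assoc, hι₁, Category.comp_id, hθ', Preadditive.comp_add,
      reassoc_of% hι₁, reassoc_of% hι₁', zero_comp, add_zero]
    rw [reassoc_of% hθ, Preadditive.add_comp, Category.assoc, Category.assoc, add_right_comm,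
      ← Preadditive.comp_add, ← e, Category.comp_id]
  -- The first factor removes the `K`-part through the chain splitting, the second removes the
  -- `Z`-part up to homotopy. Hence `E` lands in `S`, fixes `S`, and is homotopic to `𝟙 T - π ≫ ρ`.
  let E : T ⟶ T := (𝟙 T - π ≫ ρ) ≫ (𝟙 T - ν)
  have hEπ : E ≫ π = 0 := by
    simp [E, hνπ, hρ]
  have hEπ₁ : ∀ a, E.f a ≫ π₁ a = 0 := by
    intro a
    obtain ⟨θ, hθ⟩ := hνπ₁ a
    have h1 : (𝟙 T - π ≫ ρ) ≫ π = 0 := by simp [hρ]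
    have h2 := congr_hom h1 a
    rw [comp_f, zero_f_apply] at h2
    have h3 : E.f a = (𝟙 T - π ≫ ρ : T ⟶ T).f a ≫ (𝟙 _ - ν.f a) := rfl
    rw [h3, Category.assoc, Preadditive.sub_comp, Category.id_comp, hθ, sub_add_cancel_left,
      Preadditive.comp_neg, reassoc_of% h2, zero_comp, neg_zero]
  have hE : ∀ a, (E.f a ≫ j a) ≫ i.f a = E.f a := by
    intro a
    have h := congrArg (fun x => E.f a ≫ x) (hsum a)
    have h2 := congr_hom hEπ a
    rw [comp_f, zero_f_apply] at h2
    simpa [Preadditive.comp_add, reassoc_of% hEπ₁, reassoc_of% h2] using h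
  have hmono : ∀ a, Mono (i.f a) := fun a => mono_of_mono_fac (hij a)
  -- The degreewise retractions `j` need not commute with the differentials; after `E` they do,
  -- since `i` is a degreewise monomorphism.
  let ψ : T ⟶ S :=
    { f := fun a => E.f a ≫ j a
      comm' := fun a b _ => by
        rw [← cancel_mono (i.f b), Category.assoc, Category.assoc, Category.assoc,
          ← i.comm, ← Category.assoc, ← Category.assoc, hE, E.comm, hE] }
  have hψi : ψ ≫ i = E := by
    ext a
    exact hE a
  have hiψ : i ≫ ψ = 𝟙 S := by
    ext a
    have h : i ≫ E = i := by
      simp only [E, Preadditive.comp_sub, Preadditive.sub_comp, Category.comp_id, Category.id_comp,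
        Category.assoc, reassoc_of% hi, zero_comp, hiν, sub_zero]
    have h' := congr_hom h a
    rw [comp_f] at h'
    change i.f a ≫ E.f a ≫ j a = 𝟙 _
    rw [reassoc_of% h', hij]
  have hρψ : ρ ≫ ψ = 0 := by
    ext a
    have h : ρ ≫ E = 0 := by
      have h1 : ρ ≫ (𝟙 T - π ≫ ρ) = 0 := by
        rw [Preadditive.comp_sub, reassoc_of% hρ, Category.comp_id, sub_self]
      simp only [E]
      rw [← Category.assoc, h1, zero_comp]
    have h' := congr_hom h a
    rw [comp_f, zero_f_apply] at h'
    change ρ.f a ≫ E.f a ≫ j a = 0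
    rw [reassoc_of% h', zero_comp]
  have hHE : homologyMap ψ n ≫ homologyMap i n =
      𝟙 _ - homologyMap π n ≫ homologyMap ρ n := by
    rw [← homologyMap_comp, hψi]
    simp only [E]
    rw [homologyMap_comp, homologyMap_sub, homologyMap_sub, hν.homologyMap_eq, homologyMap_zero,
      homologyMap_id, sub_zero, Category.comp_id, homologyMap_comp]
  refine ⟨⟨biprod.lift (homologyMap π n) (homologyMap ψ n),
    biprod.desc (homologyMap ρ n) (homologyMap i n), ?_, ?_⟩⟩
  · rw [biprod.lift_desc, hHE, add_sub_cancel]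
  · apply biprod.hom_ext' <;> apply biprod.hom_ext
    all_goals simp [← homologyMap_comp, hρ, hi, hiψ, hρψ]

end Splitting

end HopfCyclic
end

noncomputable section

namespace HopfCyclic

/-! ### The total complex of the cyclic bicomplex in components -/

namespace CocyclicData

variable {C : Type u} [Category.{v} C] [Abelian C] {D : CocyclicData C}

namespace IsCocyclic

variable (h : D.IsCocyclic)

/-- The total complex of the cyclic bicomplex. -/
def tot : CochainComplex C ℕ := h.cyclicBicomplex.total (ComplexShape.up ℕ)

/-- The inclusion of the entry in row `q` and column `n - q` into the total complex in degree `n`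
(zero for `q > n`). -/
def inc (n q : ℕ) : D.X q ⟶ h.tot.X n :=
  if hq : q ≤ n then
    h.cyclicBicomplex.ιTotal (ComplexShape.up ℕ) (n - q) q n
      (show n - q + q = n from Nat.sub_add_cancel hq)
  else 0

lemma inc_eq_zero {n q : ℕ} (hq : n < q) : h.inc n q = 0 := by
  exact dif_neg (by omega)

lemma inc_eq {n q p : ℕ} (hpq : p + q = n) :
    h.inc n q = h.cyclicBicomplex.ιTotal (ComplexShape.up ℕ) p q n hpq := by
  obtain rfl : p = n - q := by omega
  exact dif_pos (by omega)

/-- A morphism out of the total complex given on the entries of the bicomplex. -/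
def desc (n : ℕ) {A : C} (f : ∀ q, D.X q ⟶ A) : h.tot.X n ⟶ A :=
  h.cyclicBicomplex.totalDesc fun _ q _ => f q

lemma inc_desc {n q : ℕ} (hq : q ≤ n) {A : C} (f : ∀ q, D.X q ⟶ A) :
    h.inc n q ≫ h.desc n f = f q := by
  rw [h.inc_eq (Nat.sub_add_cancel hq)]
  exact h.cyclicBicomplex.ι_totalDesc _ _ _ _

lemma inc_desc_assoc {n q : ℕ} (hq : q ≤ n) {A B : C} (f : ∀ q, D.X q ⟶ A) (g : A ⟶ B) :
    h.inc n q ≫ h.desc n f ≫ g = f q ≫ g := by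
  rw [← Category.assoc, h.inc_desc hq]

variable {h} in
lemma tot_hom_ext {n : ℕ} {A : C} {f g : h.tot.X n ⟶ A}
    (hfg : ∀ q ≤ n, h.inc n q ≫ f = h.inc n q ≫ g) : f = g := by
  refine HomologicalComplex₂.total.hom_ext (ComplexShape.up ℕ) fun p q (hpq : p + q = n) => ?_
  rw [← h.inc_eq hpq]
  exact hfg q (by omega)

lemma inc_d {n q : ℕ} (hq : q ≤ n) : h.inc n q ≫ h.tot.d n (n + 1) =
    D.horiz (n - q) q ≫ h.inc (n + 1) q +
      (-1 : ℤ) ^ (n - q) • (D.vert (n - q) q ≫ h.inc (n + 1) (q + 1)) := by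
  obtain ⟨p, rfl⟩ := Nat.exists_eq_add_of_le' hq
  rw [Nat.add_sub_cancel, h.inc_eq (p := p) rfl, h.inc_eq (p := p + 1) (q := q) (by omega),
    h.inc_eq (p := p) (q := q + 1) (by omega)]
  refine (Preadditive.comp_add _ _ _ _ _ _).trans ?_
  refine congrArg₂ (· + ·) ?_ ?_
  · refine (h.cyclicBicomplex.ι_D₁ _ _ _ _ _ _).trans ?_
    refine (h.cyclicBicomplex.d₁_eq (ComplexShape.up ℕ) (i₁ := p) (i₁' := p + 1) rfl q (p + q + 1)
      (show p + 1 + q = p + q + 1 by omega)).trans ?_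
    have h2 : (h.cyclicBicomplex.d p (p + 1)).f q = D.horiz p q :=
      congrArg (fun φ : h.column p ⟶ h.column (p + 1) => φ.f q)
        (CochainComplex.of_d h.column _ p)
    rw [h2]
    exact one_smul _ _
  · refine (h.cyclicBicomplex.ι_D₂ _ _ _ _ _ _).trans ?_
    refine (h.cyclicBicomplex.d₂_eq (ComplexShape.up ℕ) p (i₂ := q) (i₂' := q + 1) rfl (p + q + 1)
      (show p + (q + 1) = p + q + 1 by omega)).trans ?_
    have h2 : (h.cyclicBicomplex.X p).d q (q + 1) = D.vert p q := CochainComplex.of_d _ _ _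
    rw [h2]
    change ((-1 : ℤˣ) ^ p) • _ = _
    rw [Units.smul_def, Units.val_pow_eq_pow_val, Units.val_neg, Units.val_one]
    rfl

end IsCocyclic

end CocyclicData

end HopfCyclic
end

noncomputable section

namespace HopfCyclic

/-! ### Shifting complexes up by one degree -/

section ShiftUp

open scoped ZeroObject

variable {C : Type u} [Category.{v} C] [Abelian C]

/-- The complex `K` shifted up by one degree, with the zero object in degree `0`. -/
def shiftUp (K : CochainComplex C ℕ) : CochainComplex C ℕ :=
  CochainComplex.augment K (0 : (0 : C) ⟶ K.X 0) zero_comp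

lemma isZero_shiftUp_zero (K : CochainComplex C ℕ) : IsZero ((shiftUp K).X 0) := isZero_zero C

lemma isZero_homology_of_isZero_X (K : CochainComplex C ℕ) (n : ℕ) (hK : IsZero (K.X n)) :
    IsZero (K.homology n) :=
  (K.exactAt_iff_isZero_homology n).1 (HomologicalComplex.exactAt_iff K n |>.2
    (ShortComplex.exact_of_isZero_X₂ _ hK))

lemma nonempty_shiftUp_homology_iso (K : CochainComplex C ℕ) (n : ℕ) :
    Nonempty ((shiftUp K).homology (n + 1) ≅ K.homology n) := by
  have e : (shiftUp K).sc (n + 1) ≅ (shiftUp K).sc' n (n + 1) (n + 2) :=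
    (shiftUp K).isoSc' n (n + 1) (n + 2) (by simp) (by simp)
  cases n with
  | zero =>
    have e' : K.sc 0 ≅ K.sc' 0 0 1 := K.isoSc' 0 0 1 (by simp) (by simp)
    -- The predecessor of degree `0` is by convention `0` itself, with zero differential. In the
    -- shifted complex the term before is the zero object, so the left components differ; the map
    -- between them is epi, which suffices for a quasi-isomorphism.
    let φ : K.sc' 0 0 1 ⟶ (shiftUp K).sc' 0 1 2 :=
      { τ₁ := 0
        τ₂ := 𝟙 (K.X 0)
        τ₃ := 𝟙 (K.X 1)
        comm₁₂ := by
          refine zero_comp.trans ?_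
          have : (K.sc' 0 0 1).f = 0 := K.shape 0 0 (by simp)
          exact ((congrArg (· ≫ 𝟙 (K.X 0)) this).trans zero_comp).symm
        comm₂₃ := (Category.id_comp _).trans (Category.comp_id _).symm }
    have h1 : Epi φ.τ₁ := (isZero_shiftUp_zero K).epi _
    have h2 : IsIso φ.τ₂ := inferInstanceAs (IsIso (𝟙 (K.X 0)))
    have h3 : Mono φ.τ₃ := inferInstanceAs (Mono (𝟙 (K.X 1)))
    have := ShortComplex.quasiIso_of_epi_of_isIso_of_mono φ
    exact ⟨ShortComplex.homologyMapIso e ≪≫ (asIso (ShortComplex.homologyMap φ)).symm ≪≫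
      (ShortComplex.homologyMapIso e').symm⟩
  | succ n =>
    have e' : K.sc (n + 1) ≅ K.sc' n (n + 1) (n + 2) :=
      K.isoSc' n (n + 1) (n + 2) (by simp) (by simp)
    exact ⟨ShortComplex.homologyMapIso e ≪≫ (ShortComplex.homologyMapIso e').symm⟩

end ShiftUp

/-! ### Column zero, column one and the remaining columns -/

namespace CocyclicData

variable {C : Type u} [Category.{v} C] [Abelian C] {D : CocyclicData C}

/-- The morphism `X q ⟶ X m` which is the identity for `q = m` and zero otherwise. -/
def kron (D : CocyclicData C) (q m : ℕ) : D.X q ⟶ D.X m :=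
  if hq : q = m then eqToHom (by rw [hq]) else 0

@[simp] lemma kron_self (m : ℕ) : D.kron m m = 𝟙 _ := by simp [kron]

lemma kron_of_ne {q m : ℕ} (hq : q ≠ m) : D.kron q m = 0 := by simp [kron, hq]

namespace IsCocyclic

variable (h : D.IsCocyclic)

/-- The complex `(X, b)`. -/
def hoch : CochainComplex C ℕ := CochainComplex.of D.X D.b h.b_b

/-- The complex `(X, -b')`. -/
def bar : CochainComplex C ℕ :=
  CochainComplex.of D.X (fun n => -D.b' n) fun n => by simp [h.b'_b' n]

lemma hoch_d (n : ℕ) : h.hoch.d n (n + 1) = D.b n := CochainComplex.of_d _ _ _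

lemma bar_d (n : ℕ) : h.bar.d n (n + 1) = -D.b' n :=
  CochainComplex.of_d D.X (fun n => -D.b' n) n

/-- The last signed codegeneracy. -/
def barContraction (D : CocyclicData C) (n : ℕ) : D.X (n + 1) ⟶ D.X n :=
  -((-1 : ℤ) ^ n • D.σ n n)

include h in
lemma bar_contraction_zero : (-D.b' 0) ≫ barContraction D 0 = 𝟙 _ := by
  simp [b', altSum, barContraction, h.δ_σ_self 0 0 le_rfl]

include h in
-- The last codegeneracy commutes with the lower cofaces, up to a change of degree, and splits the
-- last coface occurring in `b'`. The coface that `b'` omits would contribute a second, cancelling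
-- identity; hence `b'` is contractible while `b` need not be.
lemma bar_contraction_succ (n : ℕ) : (-D.b' (n + 1)) ≫ barContraction D (n + 1) +
    barContraction D n ≫ (-D.b' n) = 𝟙 _ := by
  have h1 : D.b' (n + 1) ≫ D.σ (n + 1) (n + 1) =
      D.σ n n ≫ D.b' n + (-1 : ℤ) ^ (n + 1) • 𝟙 _ := by
    rw [b', altSum, Finset.sum_range_succ, Preadditive.add_comp, Preadditive.zsmul_comp,
      h.δ_σ_self (n + 1) (n + 1) le_rfl, b', altSum, Preadditive.sum_comp, Preadditive.comp_sum]
    congr 1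
    refine Finset.sum_congr rfl fun i hi => ?_
    rw [Finset.mem_range] at hi
    rw [Preadditive.zsmul_comp, Preadditive.comp_zsmul, h.δ_σ_lt n i n (by omega) le_rfl]
  rcases neg_one_pow_eq_or ℤ n with hn | hn <;> simp [barContraction, h1, pow_succ, hn]

/-- The degree `-1` maps of the contraction of `shiftUp h.bar`. -/
def shiftContraction : ∀ n : ℕ, (shiftUp h.bar).X (n + 1) ⟶ (shiftUp h.bar).X n
  | 0 => 0
  | n + 1 => barContraction D n

/-- The odd columns of the cyclic bicomplex are contractible. -/
def barHomotopy : Homotopy (𝟙 (shiftUp h.bar)) 0 where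
  hom i j := if hij : j + 1 = i then eqToHom (by rw [hij]) ≫ h.shiftContraction j else 0
  zero i j hij := dif_neg hij
  comm i := by
    cases i with
    | zero => exact (isZero_shiftUp_zero _).eq_of_src _ _
    | succ i =>
      rw [Homotopy.dNext_cochainComplex, Homotopy.prevD_succ_cochainComplex]
      simp only [dite_true, eqToHom_refl, Category.id_comp, HomologicalComplex.zero_f_apply,
        add_zero]
      cases i with
      | zero =>
        have e : (shiftUp h.bar).d (0 + 1) (0 + 1 + 1) = -D.b' 0 := h.bar_d 0
        rw [e, (isZero_shiftUp_zero h.bar).eq_of_src ((shiftUp h.bar).d 0 (0 + 1)) 0, comp_zero,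
          add_zero]
        exact (h.bar_contraction_zero).symm
      | succ i =>
        have e : (shiftUp h.bar).d (i + 1 + 1) (i + 1 + 1 + 1) = -D.b' (i + 1) := h.bar_d (i + 1)
        have e' : (shiftUp h.bar).d (i + 1) (i + 1 + 1) = -D.b' i := h.bar_d i
        rw [e, e']
        exact (h.bar_contraction_succ i).symm

/-- The projection onto column `0`. -/
def projZero : h.tot ⟶ h.hoch where
  f n := h.desc n fun q => D.kron q n
  comm' n m hnm := by
    obtain rfl : n + 1 = m := hnm
    rw [h.hoch_d]
    change h.desc n (fun q => D.kron q n) ≫ D.b n =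
      h.tot.d n (n + 1) ≫ h.desc (n + 1) (fun q => D.kron q (n + 1))
    refine tot_hom_ext fun q hq => ?_
    rw [h.inc_desc_assoc hq, ← Category.assoc, h.inc_d hq, Preadditive.add_comp, Category.assoc,
      h.inc_desc (by omega), Preadditive.zsmul_comp, Category.assoc, h.inc_desc (by omega),
      kron_of_ne (show q ≠ n + 1 by omega), comp_zero, zero_add]
    rcases eq_or_ne q n with rfl | hqn
    · simp [vert]
    · rw [kron_of_ne hqn, kron_of_ne (show q + 1 ≠ n + 1 by omega)]
      simp

lemma inc_projZero {n q : ℕ} (hq : q ≤ n) : h.inc n q ≫ h.projZero.f n = D.kron q n :=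
  h.inc_desc hq fun q => D.kron q n

/-- The projection onto column `1`. -/
def projOne : ∀ n : ℕ, h.tot.X n ⟶ (shiftUp h.bar).X n
  | 0 => 0
  | n + 1 => h.desc (n + 1) fun q => D.kron q n

/-- The inclusion of column `1`. -/
def incOne : ∀ n : ℕ, (shiftUp h.bar).X n ⟶ h.tot.X n
  | 0 => 0
  | n + 1 => h.inc (n + 1) n

lemma incOne_projOne (n : ℕ) : h.incOne n ≫ h.projOne n = 𝟙 _ := by
  cases n with
  | zero => exact (isZero_shiftUp_zero _).eq_of_src _ _
  | succ n => exact (h.inc_desc n.le_succ fun q => D.kron q n).trans (kron_self n)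

lemma incOne_projZero (n : ℕ) : h.incOne n ≫ h.projZero.f n = 0 := by
  cases n with
  | zero => exact zero_comp
  | succ n =>
    exact (h.inc_desc n.le_succ fun q => D.kron q (n + 1)).trans (kron_of_ne n.lt_succ_self.ne)

lemma d_projOne (n : ℕ) : ∃ θ : h.hoch.X n ⟶ (shiftUp h.bar).X (n + 1),
    h.tot.d n (n + 1) ≫ h.projOne (n + 1) =
      h.projOne n ≫ (shiftUp h.bar).d n (n + 1) + h.projZero.f n ≫ θ := by
  -- The only differential entering column `1` from another column is the horizontal one from column
  -- `0`.
  refine ⟨𝟙 _ - D.t n, tot_hom_ext fun q hq => ?_⟩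
  have hL : h.inc n q ≫ h.tot.d n (n + 1) ≫ h.projOne (n + 1) =
      D.horiz (n - q) q ≫ D.kron q n +
        (-1 : ℤ) ^ (n - q) • (D.vert (n - q) q ≫ D.kron (q + 1) n) := by
    rw [← Category.assoc, h.inc_d hq, Preadditive.add_comp, Category.assoc,
      Preadditive.zsmul_comp, Category.assoc]
    exact congrArg₂ (fun x y => D.horiz (n - q) q ≫ x + (-1 : ℤ) ^ (n - q) • (_ ≫ y))
      (h.inc_desc (by omega) _) (h.inc_desc (by omega) _)
  have hR : h.inc n q ≫ h.projZero.f n ≫ (𝟙 _ - D.t n) = D.kron q n ≫ (𝟙 _ - D.t n) :=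
    h.inc_desc_assoc hq (fun q => D.kron q n) _
  rw [hL, Preadditive.comp_add]
  refine Eq.trans ?_ (congrArg _ hR.symm)
  cases n with
  | zero =>
    obtain rfl : q = 0 := by omega
    have e : h.projOne 0 = 0 := rfl
    have key : D.horiz (0 - 0) 0 ≫ D.kron 0 0 +
        (-1 : ℤ) ^ (0 - 0) • (D.vert (0 - 0) 0 ≫ D.kron (0 + 1) 0) =
          D.kron 0 0 ≫ (𝟙 _ - D.t 0) := by
      simp [horiz, kron_of_ne]
    rw [e, zero_comp, comp_zero]
    exact key.trans (zero_add _).symm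
  | succ n =>
    have e : (shiftUp h.bar).d (n + 1) (n + 1 + 1) = -D.b' n := h.bar_d n
    have e' : h.inc (n + 1) q ≫ h.projOne (n + 1) ≫ (shiftUp h.bar).d (n + 1) (n + 1 + 1) =
        -(D.kron q n ≫ D.b' n) := by
      rw [e]
      exact (h.inc_desc_assoc hq _ _).trans (Preadditive.comp_neg _ _)
    have key : D.horiz (n + 1 - q) q ≫ D.kron q (n + 1) +
        (-1 : ℤ) ^ (n + 1 - q) • (D.vert (n + 1 - q) q ≫ D.kron (q + 1) (n + 1)) =
          -(D.kron q n ≫ D.b' n) + D.kron q (n + 1) ≫ (𝟙 _ - D.t (n + 1)) := by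
      rcases Nat.lt_trichotomy q n with hqn | rfl | hqn
      · rw [kron_of_ne (show q ≠ n by omega), kron_of_ne (show q ≠ n + 1 by omega),
          kron_of_ne (show q + 1 ≠ n + 1 by omega)]
        simp
      · rw [kron_of_ne (show q ≠ q + 1 by omega), kron_self, kron_self, Nat.add_sub_cancel_left]
        simp [vert]
      · obtain rfl : q = n + 1 := by omega
        rw [kron_of_ne (show n + 1 ≠ n by omega), kron_of_ne (show n + 1 + 1 ≠ n + 1 by omega),
          kron_self]
        simp [horiz]
    rw [e']
    exact key

lemma horiz_add_two (p q : ℕ) : D.horiz (p + 2) q = D.horiz p q := by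
  simp [horiz, Nat.even_add]

lemma vert_add_two (p q : ℕ) : D.vert (p + 2) q = D.vert p q := by
  simp [vert, Nat.even_add]

/-- The total complex shifted up by two degrees. -/
def totShift : CochainComplex C ℕ := shiftUp (shiftUp h.tot)

lemma isZero_totShift_zero : IsZero (h.totShift.X 0) := isZero_shiftUp_zero _

lemma isZero_totShift_one : IsZero (h.totShift.X 1) := isZero_shiftUp_zero h.tot

/-- The degreewise inclusion of the columns `p ≥ 2`, identified with the whole bicomplex. -/
def incShiftX : ∀ n : ℕ, h.totShift.X n ⟶ h.tot.X n
  | 0 => 0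
  | 1 => 0
  | n + 2 => h.desc n fun q => h.inc (n + 2) q

/-- The degreewise projection to the columns `p ≥ 2`. -/
def projShift : ∀ n : ℕ, h.tot.X n ⟶ h.totShift.X n
  | 0 => 0
  | 1 => 0
  -- The columns `0` and `1` correspond to $q=n+2$ and $q=n+1$, where `inc n q` is zero by
  -- convention.
  | n + 2 => h.desc (n + 2) fun q => h.inc n q

/-- The inclusion of the columns `p ≥ 2` is a morphism of complexes. -/
def incShift : h.totShift ⟶ h.tot where
  f := h.incShiftX
  comm' n m hnm := by
    obtain rfl : n + 1 = m := hnm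
    match n with
    | 0 => exact h.isZero_totShift_zero.eq_of_src _ _
    | 1 => exact h.isZero_totShift_one.eq_of_src _ _
    | n + 2 =>
      have e : h.totShift.d (n + 2) (n + 2 + 1) = h.tot.d n (n + 1) := rfl
      rw [e]
      change h.desc n (fun q => h.inc (n + 2) q) ≫ h.tot.d (n + 2) (n + 2 + 1) =
        h.tot.d n (n + 1) ≫ h.desc (n + 1) fun q => h.inc (n + 1 + 2) q
      refine tot_hom_ext fun q hq => ?_
      -- The bicomplex has period two in the column direction, and the sign $(-1)^p$ is unchanged
      -- under $p\mapsto p+2$.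
      rw [h.inc_desc_assoc hq, h.inc_d (by omega), ← Category.assoc, h.inc_d hq,
        Preadditive.add_comp, Category.assoc, h.inc_desc (by omega), Preadditive.zsmul_comp,
        Category.assoc, h.inc_desc (by omega), show n + 2 - q = n - q + 2 by omega,
        horiz_add_two, vert_add_two, pow_add]
      simp

lemma incShift_projZero : h.incShift ≫ h.projZero = 0 := by
  ext n
  match n with
  | 0 => exact h.isZero_totShift_zero.eq_of_src _ _
  | 1 => exact h.isZero_totShift_one.eq_of_src _ _
  | n + 2 =>
    change h.desc n (fun q => h.inc (n + 2) q) ≫ h.projZero.f (n + 2) = 0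
    refine tot_hom_ext fun q hq => ?_
    rw [h.inc_desc_assoc hq, h.inc_projZero (by omega), kron_of_ne (by omega), comp_zero]
    rfl

lemma incShift_projOne (n : ℕ) : h.incShift.f n ≫ h.projOne n = 0 := by
  match n with
  | 0 => exact h.isZero_totShift_zero.eq_of_src _ _
  | 1 => exact h.isZero_totShift_one.eq_of_src _ _
  | n + 2 =>
    change h.desc n (fun q => h.inc (n + 2) q) ≫ h.desc (n + 2) (fun q => D.kron q (n + 1)) = 0
    refine tot_hom_ext fun q hq => ?_
    rw [h.inc_desc_assoc hq, h.inc_desc (by omega), kron_of_ne (by omega), comp_zero]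

lemma incShift_projShift (n : ℕ) : h.incShift.f n ≫ h.projShift n = 𝟙 _ := by
  match n with
  | 0 => exact h.isZero_totShift_zero.eq_of_src _ _
  | 1 => exact h.isZero_totShift_one.eq_of_src _ _
  | n + 2 =>
    change h.desc n (fun q => h.inc (n + 2) q) ≫ h.desc (n + 2) (fun q => h.inc n q) =
      𝟙 (h.tot.X n)
    refine tot_hom_ext fun q hq => ?_
    rw [h.inc_desc_assoc hq, h.inc_desc (by omega), Category.comp_id]

lemma inc_projShift_incShift (n q : ℕ) (hq : q + 2 ≤ n) :
    h.inc n q ≫ h.projShift n ≫ h.incShift.f n = h.inc n q := by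
  obtain ⟨n, rfl⟩ : ∃ m, n = m + 2 := ⟨n - 2, by omega⟩
  exact (h.inc_desc_assoc (by omega) _ _).trans (h.inc_desc (by omega) _)

lemma inc_projShift (n q : ℕ) (hq : n < q + 2) (hqn : q ≤ n) : h.inc n q ≫ h.projShift n = 0 := by
  match n with
  | 0 => exact h.isZero_totShift_zero.eq_of_tgt _ _
  | 1 => exact h.isZero_totShift_one.eq_of_tgt _ _
  | n + 2 => exact (h.inc_desc hqn _).trans (h.inc_eq_zero (by omega))

lemma inc_projOne_incOne (n q : ℕ) (hqn : q ≤ n) :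
    h.inc n q ≫ h.projOne n ≫ h.incOne n = if q + 1 = n then h.inc n q else 0 := by
  match n with
  | 0 =>
    rw [if_neg (by omega)]
    have e : h.projOne 0 = 0 := rfl
    rw [e, zero_comp, comp_zero]
  | n + 1 =>
    refine (h.inc_desc_assoc hqn _ _).trans ?_
    split_ifs with hq
    · obtain rfl : q = n := by omega
      rw [kron_self]
      exact Category.id_comp _
    · rw [kron_of_ne (show q ≠ n by omega)]
      exact zero_comp

lemma sum_proj_inc (n : ℕ) : h.projShift n ≫ h.incShift.f n +
    h.projZero.f n ≫ (show h.hoch.X n ⟶ h.tot.X n from h.inc n n) +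
    h.projOne n ≫ h.incOne n = 𝟙 _ := by
  refine tot_hom_ext fun q hq => ?_
  have h0 : h.inc n q ≫ h.projZero.f n ≫ (show h.hoch.X n ⟶ h.tot.X n from h.inc n n) =
      D.kron q n ≫ h.inc n n := h.inc_desc_assoc hq (fun q => D.kron q n) _
  rw [Preadditive.comp_add, Preadditive.comp_add, h0, h.inc_projOne_incOne n q hq,
    Category.comp_id]
  by_cases h1 : q + 2 ≤ n
  · rw [h.inc_projShift_incShift n q h1, kron_of_ne (by omega), if_neg (by omega), zero_comp,
      add_zero, add_zero]
  · rw [← Category.assoc, h.inc_projShift n q (by omega) hq, zero_comp, zero_add]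
    by_cases h2 : q + 1 = n
    · rw [if_pos h2, kron_of_ne (by omega), zero_comp, zero_add]
    · obtain rfl : q = n := by omega
      rw [if_neg h2, kron_self, Category.id_comp, add_zero]

/-- The morphism of complexes from `(X, b)` to the total complex given by a trivialization. -/
def ofTrivialization {ρ : ∀ n q : ℕ, D.X n ⟶ D.X q} (hρ : D.IsTrivialization ρ) :
    h.hoch ⟶ h.tot where
  f n := ∑ q ∈ Finset.range (n + 1), ρ n q ≫ h.inc n q
  comm' n m hnm := by
    obtain rfl : n + 1 = m := hnm
    rw [h.hoch_d]
    change (∑ q ∈ Finset.range (n + 1), ρ n q ≫ h.inc n q : D.X n ⟶ h.tot.X n) ≫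
      h.tot.d n (n + 1) =
        D.b n ≫ (∑ q ∈ Finset.range (n + 1 + 1), ρ (n + 1) q ≫ h.inc (n + 1) q :
          D.X (n + 1) ⟶ h.tot.X (n + 1))
    rw [Preadditive.sum_comp, Preadditive.comp_sum, Finset.sum_range_succ' _ (n + 1)]
    have h1 : ∀ q ∈ Finset.range (n + 1), (ρ n q ≫ h.inc n q) ≫ h.tot.d n (n + 1) =
        ρ n q ≫ D.horiz (n - q) q ≫ h.inc (n + 1) q +
          (-1 : ℤ) ^ (n - q) • (ρ n q ≫ D.vert (n - q) q ≫ h.inc (n + 1) (q + 1)) := by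
      intro q hq
      rw [Finset.mem_range] at hq
      rw [Category.assoc, h.inc_d (by omega), Preadditive.comp_add, Preadditive.comp_zsmul]
    have h2 : ∀ q ∈ Finset.range (n + 1), D.b n ≫ ρ (n + 1) (q + 1) ≫ h.inc (n + 1) (q + 1) =
        ρ n (q + 1) ≫ D.horiz (n - (q + 1)) (q + 1) ≫ h.inc (n + 1) (q + 1) +
          (-1 : ℤ) ^ (n - q) • (ρ n q ≫ D.vert (n - q) q ≫ h.inc (n + 1) (q + 1)) := by
      intro q hq
      rw [← Category.assoc, hρ.b_comp_succ]
      simp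
    rw [Finset.sum_congr rfl h1, Finset.sum_congr rfl h2, Finset.sum_add_distrib,
      Finset.sum_add_distrib, ← Category.assoc (D.b n), hρ.b_comp_zero, add_right_comm]
    congr 1
    -- The horizontal terms on the two sides differ by an index shift: row `0` is split off on one
    -- side, and the extra row `n + 1` contributes zero because `ρ n (n + 1) = 0`.
    have h3 := Finset.sum_range_succ' (fun q => ρ n q ≫ D.horiz (n - q) q ≫ h.inc (n + 1) q)
      (n + 1)
    rw [Finset.sum_range_succ, hρ.eq_zero n (n + 1) (by omega), zero_comp, add_zero] at h3
    rw [h3, Category.assoc, Nat.sub_zero]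

lemma ofTrivialization_projZero {ρ : ∀ n q : ℕ, D.X n ⟶ D.X q} (hρ : D.IsTrivialization ρ) :
    h.ofTrivialization hρ ≫ h.projZero = 𝟙 _ := by
  ext n
  change (∑ q ∈ Finset.range (n + 1), ρ n q ≫ h.inc n q) ≫ h.projZero.f n = 𝟙 (D.X n)
  rw [Preadditive.sum_comp, Finset.sum_eq_single n]
  · rw [Category.assoc, h.inc_projZero le_rfl, kron_self, hρ.self]
    exact Category.id_comp _
  · intro q hq hqn
    rw [Finset.mem_range] at hq
    rw [Category.assoc, h.inc_projZero (by omega), kron_of_ne hqn]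
    exact comp_zero
  · simp

/-- A trivialization splits the periodicity sequence of cyclic cohomology. -/
theorem nonempty_tot_homology_iso {ρ : ∀ n q : ℕ, D.X n ⟶ D.X q} (hρ : D.IsTrivialization ρ)
    (n : ℕ) : Nonempty (h.tot.homology n ≅ h.hoch.homology n ⊞ h.totShift.homology n) :=
  nonempty_homology_iso_of_splitting h.projZero (h.ofTrivialization hρ)
    (h.ofTrivialization_projZero hρ) h.incShift h.incShift_projZero h.projShift
    h.incShift_projShift (fun n => h.inc n n) h.incOne h.projOne h.incOne_projOne
    h.incOne_projZero h.incShift_projOne h.sum_proj_inc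
    (fun n m => by
      by_cases hnm : n + 1 = m
      · subst hnm
        exact h.d_projOne n
      · exact ⟨0, by rw [h.tot.shape n m hnm, (shiftUp h.bar).shape n m hnm]; simp⟩)
    h.barHomotopy n

end IsCocyclic

end CocyclicData

end HopfCyclic
end

noncomputable section

namespace HopfCyclic

/-! ### Unrolling the two-step recursion into a biproduct -/

section Biproducts

variable {C : Type u} [Category.{v} C] [Abelian C]

/-- A biproduct over `Option J` is the binary biproduct of the summand at `none` and the biproduct
over `J`. -/
def biproductOptionIso {J : Type} [Finite J] (f : Option J → C) :
    ⨁ f ≅ f none ⊞ ⨁ fun j => f (some j) where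
  hom := biproduct.desc fun
    | none => biprod.inl
    | some j => biproduct.ι (fun j => f (some j)) j ≫ biprod.inr
  inv := biprod.desc (biproduct.ι f none) (biproduct.desc fun j => biproduct.ι f (some j))
  hom_inv_id := by
    refine biproduct.hom_ext' _ _ fun j => ?_
    cases j <;> simp
  inv_hom_id := by
    refine biprod.hom_ext' _ _ ?_ ?_
    · simp
    · refine biproduct.hom_ext' _ _ fun j => ?_
      simp

/-- The natural numbers `i ≤ n` with the parity of `n`. -/
abbrev ParityIndex (n : ℕ) : Type := {i : Fin (n + 1) // (i : ℕ) ≡ n [MOD 2]}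

/-- The map from `Option (ParityIndex n)` to `ParityIndex (n + 2)` sending `none` to `n + 2`. -/
def parityIndexMap (n : ℕ) : Option (ParityIndex n) → ParityIndex (n + 2)
  | none => ⟨⟨n + 2, by omega⟩, rfl⟩
  | some i => ⟨⟨i, by omega⟩, i.2.trans (by simp [Nat.ModEq])⟩

lemma parityIndexMap_bijective (n : ℕ) : Function.Bijective (parityIndexMap n) := by
  constructor
  · rintro (_ | ⟨⟨i, hi⟩, hi'⟩) (_ | ⟨⟨j, hj⟩, hj'⟩) hij
    · rfl
    · have : n + 2 = j := congrArg (fun k => (k.1 : ℕ)) hij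
      omega
    · have : i = n + 2 := congrArg (fun k => (k.1 : ℕ)) hij
      omega
    · obtain rfl : i = j := congrArg (fun k => (k.1 : ℕ)) hij
      rfl
  · rintro ⟨⟨i, hi⟩, hi'⟩
    by_cases h : i = n + 2
    · exact ⟨none, by subst h; rfl⟩
    · have hi'' : i % 2 = (n + 2) % 2 := hi'
      exact ⟨some ⟨⟨i, by omega⟩, show i % 2 = n % 2 by omega⟩, rfl⟩

lemma nonempty_iso_biproduct_of_recursion (T A : ℕ → C) (h0 : Nonempty (T 0 ≅ A 0))
    (h1 : Nonempty (T 1 ≅ A 1)) (h2 : ∀ n, Nonempty (T (n + 2) ≅ A (n + 2) ⊞ T n)) :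
    ∀ n : ℕ, Nonempty (T n ≅ ⨁ fun i : ParityIndex n => A i)
  | 0 => by
    let _ : Unique (ParityIndex 0) := ⟨⟨⟨0, rfl⟩⟩, fun i => Subtype.ext (Fin.ext (by omega))⟩
    exact ⟨h0.some ≪≫ (biproductUniqueIso fun i : ParityIndex 0 => A i).symm⟩
  | 1 => by
    let _ : Unique (ParityIndex 1) := ⟨⟨⟨1, rfl⟩⟩, fun i => Subtype.ext (Fin.ext (by
      have hi : (i.1 : ℕ) % 2 = 1 % 2 := i.2
      have hi' := i.1.2
      change (i.1 : ℕ) = 1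
      omega))⟩
    exact ⟨h1.some ≪≫ (biproductUniqueIso fun i : ParityIndex 1 => A i).symm⟩
  | n + 2 => by
    obtain ⟨e⟩ := nonempty_iso_biproduct_of_recursion T A h0 h1 h2 n
    have e' : (⨁ fun i : Option (ParityIndex n) => A (parityIndexMap n i)) ≅
        ⨁ fun i : ParityIndex (n + 2) => A i :=
      biproduct.whiskerEquiv (Equiv.ofBijective _ (parityIndexMap_bijective n))
        (f := fun i : Option (ParityIndex n) => A (parityIndexMap n i))
        (g := fun i : ParityIndex (n + 2) => A i) fun _ => Iso.refl _
    exact ⟨(h2 n).some ≪≫ biprod.mapIso (Iso.refl _) e ≪≫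
      (biproductOptionIso fun i : Option (ParityIndex n) => A (parityIndexMap n i)).symm ≪≫ e'⟩

end Biproducts

/-! ### Cyclic cohomology of a cocyclic object with a trivialization -/

namespace CocyclicData.IsCocyclic

variable {C : Type u} [Category.{v} C] [Abelian C] {D : CocyclicData C} (h : D.IsCocyclic)

lemma nonempty_totShift_homology_iso (n : ℕ) :
    Nonempty (h.totShift.homology (n + 2) ≅ h.tot.homology n) :=
  ⟨(nonempty_shiftUp_homology_iso (shiftUp h.tot) (n + 1)).some ≪≫
    (nonempty_shiftUp_homology_iso h.tot n).some⟩

/-- A trivialization splits cyclic cohomology into the Hochschild cohomology groups in degrees of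
the same parity. -/
theorem nonempty_tot_homology_iso_biproduct {ρ : ∀ n q : ℕ, D.X n ⟶ D.X q}
    (hρ : D.IsTrivialization ρ) (n : ℕ) :
    Nonempty (h.tot.homology n ≅ ⨁ fun i : ParityIndex n => h.hoch.homology i) := by
  -- In degrees `0` and `1` there is no column $p\ge2$, so cyclic and Hochschild cohomology agree.
  have low (m : ℕ) (hm : IsZero (h.totShift.homology m)) :
      Nonempty (h.tot.homology m ≅ h.hoch.homology m) :=
    ⟨(h.nonempty_tot_homology_iso hρ m).some ≪≫ (isoBiprodZero hm).symm⟩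
  refine nonempty_iso_biproduct_of_recursion (fun m => h.tot.homology m)
    (fun m => h.hoch.homology m)
    (low 0 (isZero_homology_of_isZero_X _ 0 h.isZero_totShift_zero))
    (low 1 (isZero_homology_of_isZero_X _ 1 h.isZero_totShift_one)) (fun m => ?_) n
  exact ⟨(h.nonempty_tot_homology_iso hρ (m + 2)).some ≪≫
    biprod.mapIso (Iso.refl _) (h.nonempty_totShift_homology_iso m).some⟩

end CocyclicData.IsCocyclic

end HopfCyclic

end

theorem mainTheorem6 {C : Type u} [Category.{v} C] [Abelian C] [MonoidalCategory C]
    [SymmetricCategory C] (H : C) [HopfObj H] [IsCommMonObj H] :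
    HopfCyclic.IsModularPairInInvolution H ε[H] η[H] ∧
      ∃ h : (HopfCyclic.hopfCocyclicData H ε[H] η[H]).IsCocyclic, ∀ n : ℕ,
        Nonempty (h.cyclicCohomology n ≅
          ⨁ fun i : {i : Fin (n + 1) // (i : ℕ) ≡ n [MOD 2]} =>
            HopfCyclic.hochschildCohomology H i) := by
  obtain ⟨_, hρ⟩ := HopfCyclic.exists_isTrivialization H
  -- For this cocyclic object `hoch` unfolds to the Hochschild complex of the coalgebra $H$ with
  -- both coactions given by $\eta$, and `tot` to the total complex defining cyclic cohomology.
  exact ⟨HopfCyclic.isModularPairInInvolution H, HopfCyclic.hopfCocyclicData_isCocyclic H,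
    fun n => (HopfCyclic.hopfCocyclicData_isCocyclic H).nonempty_tot_homology_iso_biproduct hρ n⟩
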